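/- **Setting.** Let $1\le r\le H$, $K=\binom{H}{r}$, $N\ge K$ and $M\in[0,N]$. A server holding $N$ independent, uniformly distributed files $F_1,\dots,F_N$ of $B$ bits each is connected to $H$ relays. There are $K$ users, one for each $r$-subset of the relays; user $k$ is connected to the relays in its subset $\mathcal H_k\subseteq[H]$. For $\mathcal J\subseteq[H]$ put $\mathcal K_{\mathcal J}=\{k\in[K]:\mathcal H_k\subseteq\mathcal J\}$. In a scheme with uncoded placement, user $k$ stores at most $MB$ bits copied from the files, chosen without knowledge of the demands. Then user $k$ demands file $F_{d_k}$, $\mathbf d\in[N]^K$; the server sends a message $X_h$ to each relay $h$; relay $h$ sends to each user connected to it a function of $X_h$; and user $k$ estimates $F_{d_k}$ from its cache and the messages received from the relays in $\mathcal H_k$. The scheme has load at most $R$ if for every $\mathbf d$ every link carries at most $RB$ bits. The load $R$ is achievable if for each $\varepsilon>0$ there are a file size $B\ge1$ and a scheme of load at most $R$ in which, for every $\mathbf d$, every user errs with probability at most $\varepsilon$. Let $R^\star_{\mathrm u}$ be the infimum of the achievable loads. For a scheme, let $F_{i,\mathcal W}$ be the set of bits of $F_i$ stored by the users in $\mathcal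 W\subseteq[K]$ and by no others, and let $x_{\mathcal W}=\frac1{NB}\sum_{i\in[N]}|F_{i,\mathcal W}|$. For a permutation $\mathbf p$ of $[K]$ and $\mathcal Q\subseteq[H]$, let $\mathbf g=(g_1,\dots,g_m)$ be the vector $\mathbf p$ without its entries in $\mathcal K_{\mathcal Q}$, let $$\mathcal S_{\mathcal Q,\mathbf p}(\mathbf d)=\bigcup_{i\in[m]}\big\{F_{d_{g_i},\mathcal W}:\mathcal W\subseteq([K]\setminus\mathcal K_{\mathcal Q})\setminus\{g_1,\dots,g_i\}\big\},$$ let $y_{\mathcal Q,\mathbf p}$ be the average, over the demand vectors $\mathbf d$ with pairwise distinct entries, of $\frac1B H\big(X_{\mathcal Q}\mid\text{all sub-files }F_{i,\mathcal W}\text{ not in }\mathcal S_{\mathcal Q,\mathbf p}(\mathbf d)\big)$, where $X_{\mathcal Q}=(X_h)_{h\in\mathcal Q}$ and entropies are in bits, and let $y_{\mathcal Q}=\max_{\mathbf p}y_{\mathcal Q,\mathbf p}$. **Constraints.** For real variables $R$, $x_{\mathcal W}$ ($\mathcal W\subseteq[K]$) and $y_{\mathcal Q}$ ($\mathcal Q\subseteq[H]$)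 consider: 1. $x_{\mathcal W}\ge0$, $\ \sum_{\mathcal W\subseteq[K]}x_{\mathcal W}=1$, and $\sum_{\mathcal W\ni k}x_{\mathcal W}\le M/N$ for all $k\in[K]$. 2. For every $\mathcal Q\subseteq[H]$ with $|\mathcal Q|\in[r:H]$, every integer $1\le a\le\lfloor|\mathcal Q|/r\rfloor$, every partition $\mathcal Q=\mathcal Q_1\cup\dots\cup\mathcal Q_a$ into disjoint blocks with $|\mathcal Q_i|\ge r$, all permutations $\mathbf p^{(i)}$ of $\mathcal K_{\mathcal Q_i}$ ($i\in[a]$) and every permutation $\mathbf q$ of $\mathcal K_{\mathcal Q}\setminus\mathcal V$, where $\mathcal V=\bigcup_{i\in[a]}\mathcal K_{\mathcal Q_i}$: $$|\mathcal Q|R\ \ge\ \sum_{i\in[a]}\ \sum_{j\in[|\mathcal K_{\mathcal Q_i}|]}\ \sum_{\mathcal W\subseteq[K]\setminus\{p^{(i)}_1,\dots,p^{(i)}_j\}}x_{\mathcal W}\ +\sum_{j\in[|\mathcal K_{\mathcal Q}\setminus\mathcal V|]}\ \sum_{\mathcal W\subseteq([K]\setminus\mathcal V)\setminus\{q_1,\dots,q_j\}}x_{\mathcal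 W}\ +\ y_{\mathcal Q}.$$ 3. For every $b\in[r:H]$ and every permutation $\mathbf p$ of $[K]$: $$\sum_{\mathcal Q\subseteq[H]:|\mathcal Q|=b}y_{\mathcal Q}\ \ge\ \sum_{i\in[K]}\ \sum_{\mathcal W\subseteq[K]\setminus\{p_1,\dots,p_i\}}c\big(\{p_i\}\cup\mathcal W,b\big)\,x_{\mathcal W},$$ where $c(\mathcal W_1,l)=\max\Big\{\binom{H-1}{l-1}-\big|\{\mathcal Q\subseteq[H]:|\mathcal Q|=l,\ \mathcal K_{\mathcal Q}\nsubseteq[K]\setminus\mathcal W_1\}\big|,\,0\Big\}$. **Theorem.** (a) For each $\eta>0$ there is $\varepsilon>0$ (depending only on $H,r,N,M,\eta$) such that for every $B\ge1$ and every scheme with uncoded placement, file size $B$, load at most $R$ and error probability at most $\varepsilon$ (for every demand vector and every user), the numbers $x_{\mathcal W}$ and $y_{\mathcal Q}$ of that scheme satisfy 1 exactly, and satisfy 2 and 3 with $\eta$ added to the larger side of each inequality. (b) There are real numbers $x_{\mathcal W}$, $y_{\mathcal Q}$ such that $(R^\star_{\mathrm u},x,y)$ satisfies 1, 2 and 3.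 (c) The set of the $(R,x,y)$ satisfying 1, 2 and 3 is given by finitely many linear inequalities; minimizing $R$ over it is a linear program whose minimum is attained and is a lower bound for $R^\star_{\mathrm u}$. -/

import Mathlib

open Finset

namespace CombNet

/-- Users of the combination network with `H` relays: there is exactly one user for each
`r`-element set of relays, namely the set `𝓗_k` of the relays to which that user is connected.
Hence the number of users is `K = H.choose r`. -/
abbrev User (H r : ℕ) : Type := {s : Finset (Fin H) // s.card = r}

/-- `N` files of `B` bits each; the library is uniformly distributed over this finite type. -/
abbrev Library (N B : ℕ) : Type := Fin N → Fin B → Bool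

/-- A demand vector: user `k` wants file `d k`. -/
abbrev Demand (H r N : ℕ) : Type := User H r → Fin N

/-- `𝓚_J`: the users all of whose relays are in `J`. -/
def usersWithin {H : ℕ} (r : ℕ) (J : Finset (Fin H)) : Finset (User H r) :=
  univ.filter fun k => k.1 ⊆ J

/-- `l` is a permutation vector of the finite set `S`. -/
def IsPermOf {α : Type} [DecidableEq α] (S : Finset α) (l : List α) : Prop :=
  l.Nodup ∧ l.toFinset = S

/-! ### Entropy of functions of a uniformly distributed variable -/

open Classical in
/-- Shannon entropy, in bits, of `X ω` for `ω` uniformly distributed on `Ω`. -/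
noncomputable def entropy {Ω α : Type} [Fintype Ω] [Fintype α] (X : Ω → α) : ℝ :=
  (∑ a : α, Real.negMulLog
    (((univ.filter fun w : Ω => X w = a).card : ℝ) / (Fintype.card Ω : ℝ))) / Real.log 2

/-- Conditional entropy `H(X | Y) = H(X, Y) - H(Y)`. -/
noncomputable def condEntropy {Ω α β : Type} [Fintype Ω] [Fintype α] [Fintype β]
    (X : Ω → α) (Y : Ω → β) : ℝ :=
  entropy (fun w => (X w, Y w)) - entropy Y

/-! ### Caching schemes with uncoded placement -/

/-- A scheme with uncoded cache placement and file size `B`. The placement does not depend on the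
demands: user `k` stores the bits of the library whose positions are in `cache k`. For each demand
vector, the server sends `relayBits d h` bits to relay `h`, each relay sends `linkBits d k h` bits,
computed from what it received, to each user `k` connected to it, and each user estimates its file
from its cache and the bits received from its relays. -/
structure UncodedScheme (H r N B : ℕ) where
  cache : User H r → Finset (Fin N × Fin B)
  relayBits : Demand H r N → Fin H → ℕ
  encode : (d : Demand H r N) → (h : Fin H) → Library N B → (Fin (relayBits d h) → Bool)
  linkBits : Demand H r N → (k : User H r) → (h : {h : Fin H // h ∈ k.1}) → ℕ
  forward : (d : Demand H r N) → (k : User H r) → (h : {h : Fin H // h ∈ k.1}) →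
    (Fin (relayBits d h.1) → Bool) → (Fin (linkBits d k h) → Bool)
  decode : (d : Demand H r N) → (k : User H r) →
    ({b : Fin N × Fin B // b ∈ cache k} → Bool) →
    ((h : {h : Fin H // h ∈ k.1}) → (Fin (linkBits d k h) → Bool)) → (Fin B → Bool)

namespace UncodedScheme

variable {H r N B : ℕ}

/-- Each cache holds at most `M * B` bits. -/
def MemoryAtMost (S : UncodedScheme H r N B) (M : ℝ) : Prop :=
  ∀ k, ((S.cache k).card : ℝ) ≤ M * B

/-- For each demand vector, every link carries at most `R * B` bits. -/
def LoadAtMost (S : UncodedScheme H r N B) (R : ℝ) : Prop :=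
  (∀ d h, (S.relayBits d h : ℝ) ≤ R * B) ∧ ∀ d k h, (S.linkBits d k h : ℝ) ≤ R * B

/-- The estimate made by user `k` when the demands are `d` and the library is `w`. -/
def estimate (S : UncodedScheme H r N B) (d : Demand H r N) (k : User H r)
    (w : Library N B) : Fin B → Bool :=
  S.decode d k (fun b => w b.1.1 b.1.2) (fun h => S.forward d k h (S.encode d h.1 w))

/-- For each demand vector, every user errs with probability at most `ε`. -/
def ErrorAtMost (S : UncodedScheme H r N B) (ε : ℝ) : Prop :=
  ∀ d k, (((univ.filter fun w : Library N B => S.estimate d k w ≠ w (d k)).card : ℝ) /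
    (Fintype.card (Library N B) : ℝ)) ≤ ε

/-- The set of users which store the bit in position `b`. -/
def owners (S : UncodedScheme H r N B) (b : Fin N × Fin B) : Finset (User H r) :=
  univ.filter fun k => b ∈ S.cache k

/-- `|F_{i,W}|`: the number of bits of file `i` stored by the users in `W` and by no others. -/
def subfileSize (S : UncodedScheme H r N B) (i : Fin N) (W : Finset (User H r)) : ℕ :=
  (univ.filter fun j : Fin B => S.owners (i, j) = W).card

/-- `x_W = (1 / (N B)) ∑_i |F_{i,W}|`. -/
noncomputable def x (S : UncodedScheme H r N B) (W : Finset (User H r)) : ℝ :=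
  (∑ i : Fin N, (S.subfileSize i W : ℝ)) / ((N : ℝ) * (B : ℝ))

/-- `X_Q`: the messages sent by the server to the relays in `Q`. -/
def relayMessages (S : UncodedScheme H r N B) (d : Demand H r N) (Q : Finset (Fin H))
    (w : Library N B) : (h : {h : Fin H // h ∈ Q}) → (Fin (S.relayBits d h.1) → Bool) :=
  fun h => S.encode d h.1 w

/-- All sub-files `F_{i,W}` except those with `(i, W) ∈ T`. -/
def otherSubfiles (S : UncodedScheme H r N B) (T : Finset (Fin N × Finset (User H r)))
    (w : Library N B) : {b : Fin N × Fin B // (b.1, S.owners b) ∉ T} → Bool :=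
  fun b => w b.1.1 b.1.2

end UncodedScheme

/-- `f(d, A, v) = ⋃_i {F_{d_{v_i}, W} : W ⊆ A \ {v_1, …, v_i}}`, where the sub-file `F_{n,W}` is
named by the pair `(n, W)`. -/
def acyclicSet {H r N : ℕ} (d : Demand H r N) (A : Finset (User H r)) (v : List (User H r)) :
    Finset (Fin N × Finset (User H r)) :=
  univ.biUnion fun i : Fin v.length =>
    (A \ (v.take (i + 1)).toFinset).powerset.image fun W => (d (v.get i), W)

/-- The demand vectors in which different users want different files. -/
def distinctDemands (H r N : ℕ) : Finset (Demand H r N) :=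
  univ.filter fun d => Function.Injective d

namespace UncodedScheme

variable {H r N B : ℕ}

/-- `y_{Q,p}`: the average over the demand vectors with distinct demands of
`H(X_Q | all sub-files not in S_Q) / B`, where `S_Q = f(d, [K] \ 𝓚_Q, g([K] \ 𝓚_Q, p))` and
`g(A, p)` is the vector `p` without its entries outside `A`. -/
noncomputable def yPerm (S : UncodedScheme H r N B) (Q : Finset (Fin H))
    (p : List (User H r)) : ℝ :=
  (∑ d ∈ distinctDemands H r N,
    condEntropy (S.relayMessages d Q)
      (S.otherSubfiles (acyclicSet d (univ \ usersWithin r Q)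
        (p.filter fun k => k ∈ univ \ usersWithin r Q)))) /
    (((distinctDemands H r N).card : ℝ) * (B : ℝ))

/-- `y_Q`: the maximum of `y_{Q,p}` over the permutations `p` of the set of all users. -/
noncomputable def y (S : UncodedScheme H r N B) (Q : Finset (Fin H)) : ℝ :=
  ⨆ p : {p : List (User H r) // IsPermOf univ p}, S.yPerm Q p.1

/-- The supremum in the definition of `y` is a maximum. -/
theorem isGreatest_y (S : UncodedScheme H r N B) (Q : Finset (Fin H)) :
    IsGreatest {t | ∃ p : List (User H r), IsPermOf univ p ∧ t = S.yPerm Q p} (S.y Q) := by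
  have hfin : Finite {p : List (User H r) // IsPermOf univ p} :=
    Finite.of_injective
      (fun p => (⟨p.1, p.2.1⟩ : {l : List (User H r) // l.Nodup}))
      (fun p q h => Subtype.ext (by simpa using h))
  have hne : Nonempty {p : List (User H r) // IsPermOf univ p} :=
    ⟨⟨univ.toList, nodup_toList _, toList_toFinset _⟩⟩
  constructor
  · obtain ⟨p, hp⟩ := exists_eq_ciSup_of_finite
      (f := fun p : {p : List (User H r) // IsPermOf univ p} => S.yPerm Q p.1)
    exact ⟨p.1, p.2, hp.symm⟩
  · rintro t ⟨p, hp, rfl⟩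
    exact le_ciSup (f := fun p : {p : List (User H r) // IsPermOf univ p} => S.yPerm Q p.1)
      (Set.finite_range _).bddAbove ⟨p, hp⟩

end UncodedScheme

/-! ### The optimal max-link load under uncoded placement -/

/-- The load `R` is achievable with uncoded placement and memory `M`: for each `ε > 0` there are a
file size and a scheme of load at most `R` with error probability at most `ε`. -/
def Achievable (H r N : ℕ) (M R : ℝ) : Prop :=
  ∀ ε : ℝ, 0 < ε → ∃ B : ℕ, 1 ≤ B ∧ ∃ S : UncodedScheme H r N B,
    S.MemoryAtMost M ∧ S.LoadAtMost R ∧ S.ErrorAtMost ε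

/-- `R*_u`: the optimal max-link load under uncoded placement. -/
noncomputable def optimalLoad (H r N : ℕ) (M : ℝ) : ℝ :=
  sInf {R : ℝ | Achievable H r N M R}

/-- The infimum in the definition of `optimalLoad` is a genuine one. -/
theorem isGLB_optimalLoad (H r N : ℕ) (M : ℝ) (hr : 1 ≤ r) (hrH : r ≤ H) (hN : 1 ≤ N)
    (hM : 0 ≤ M) : IsGLB {R : ℝ | Achievable H r N M R} (optimalLoad H r N M) := by
  have hne : {R : ℝ | Achievable H r N M R}.Nonempty := by
    have hk : ∀ k : User H r, k.1.Nonempty := fun k =>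
      card_pos.mp (by rw [k.2]; exact hr)
    let S : UncodedScheme H r N 1 :=
      { cache := fun _ => ∅
        relayBits := fun _ _ => N
        encode := fun _ _ w i => w i 0
        linkBits := fun _ _ _ => N
        forward := fun _ _ _ m => m
        decode := fun d k _ m _ => m ⟨(hk k).choose, (hk k).choose_spec⟩ (d k) }
    refine ⟨(N : ℝ), fun ε hε => ⟨1, le_rfl, S, ?_, ⟨?_, ?_⟩, ?_⟩⟩
    · intro k
      simp [S, hM]
    · intro d h
      simp [S]
    · intro d k h
      simp [S]
    · intro d k
      have h0 : (univ.filter fun w : Library N 1 => S.estimate d k w ≠ w (d k)) = ∅ := by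
        refine filter_eq_empty_iff.mpr fun w _ hw => hw ?_
        funext j
        rw [Subsingleton.elim j 0]
        rfl
      rw [h0]
      simpa using hε.le
  refine Real.isGLB_sInf hne ⟨0, fun R hR => ?_⟩
  obtain ⟨B, hB, S, -, hS, -⟩ := hR 1 one_pos
  have hB' : (0 : ℝ) < B := by exact_mod_cast hB
  have h1 := hS.1 (fun _ => ⟨0, hN⟩) ⟨0, lt_of_lt_of_le hr hrH⟩
  exact nonneg_of_mul_nonneg_left (le_trans (Nat.cast_nonneg _) h1) hB'

/-! ### The constraints of the outer bound -/

/-- `∑_{j ∈ [|v|]} ∑_{W ⊆ A \ {v_1, …, v_j}} x_W`. -/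
def chainSum {H r : ℕ} (x : Finset (User H r) → ℝ) (A : Finset (User H r))
    (v : List (User H r)) : ℝ :=
  ∑ j : Fin v.length, ∑ W ∈ (A \ (v.take (j + 1)).toFinset).powerset, x W

/-- The coefficient `c(W₁, l)`. -/
def coeffC (H r : ℕ) (W₁ : Finset (User H r)) (l : ℕ) : ℝ :=
  max (((H - 1).choose (l - 1) : ℝ) -
    ((univ.filter fun Q : Finset (Fin H) =>
      Q.card = l ∧ ¬ usersWithin r Q ⊆ univ \ W₁).card : ℝ)) 0

/-- `∑_{i ∈ [|v|]} ∑_{W ⊆ [K] \ {v_1, …, v_i}} c({v_i} ∪ W, b) x_W`. -/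
def weightedChainSum {H r : ℕ} (x : Finset (User H r) → ℝ) (b : ℕ) (v : List (User H r)) : ℝ :=
  ∑ i : Fin v.length, ∑ W ∈ (univ \ (v.take (i + 1)).toFinset).powerset,
    coeffC H r (insert (v.get i) W) b * x W

/-- The constraints on `x` coming from the file length and from the memory size. -/
structure PlacementConstraints {H r : ℕ} (N : ℕ) (M : ℝ) (x : Finset (User H r) → ℝ) : Prop where
  nonneg : ∀ W, 0 ≤ x W
  sum_eq_one : ∑ W, x W = 1
  memory : ∀ k : User H r, ∑ W ∈ univ.filter (fun W : Finset (User H r) => k ∈ W), x W ≤ M / N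

/-- The combined load constraints, up to an additive slack `η`: for every set `Q` of at least `r`
relays, every partition of `Q` into `1 ≤ a ≤ ⌊|Q| / r⌋` blocks `P i` of size at least `r`, every
permutation `p i` of `𝓚_{P i}` and every permutation `q` of `𝓚_Q \ V`, where `V` is the union of
the sets `𝓚_{P i}`. -/
def LoadConstraints {H r : ℕ} (R : ℝ) (x : Finset (User H r) → ℝ) (y : Finset (Fin H) → ℝ)
    (η : ℝ) : Prop :=
  ∀ (Q : Finset (Fin H)), r ≤ Q.card →
  ∀ (a : ℕ), 1 ≤ a → a ≤ Q.card / r →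
  ∀ (P : Fin a → Finset (Fin H)), (∀ i, r ≤ (P i).card) →
    (∀ i j, i ≠ j → Disjoint (P i) (P j)) → univ.biUnion P = Q →
  ∀ (p : Fin a → List (User H r)), (∀ i, IsPermOf (usersWithin r (P i)) (p i)) →
  ∀ (V : Finset (User H r)), V = univ.biUnion (fun i => usersWithin r (P i)) →
  ∀ (q : List (User H r)), IsPermOf (usersWithin r Q \ V) q →
    (∑ i, chainSum x univ (p i)) + chainSum x (univ \ V) q + y Q ≤ (Q.card : ℝ) * R + η

/-- The constraints on the sums of the `y_Q` with `|Q| = b`, up to an additive slack `η`, for each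
`b ∈ [r : H]` and each permutation of the set of all users. -/
def YConstraints {H r : ℕ} (x : Finset (User H r) → ℝ) (y : Finset (Fin H) → ℝ) (η : ℝ) : Prop :=
  ∀ b : ℕ, r ≤ b → b ≤ H → ∀ p : List (User H r), IsPermOf univ p →
    weightedChainSum x b p ≤ (∑ Q ∈ univ.filter (fun Q : Finset (Fin H) => Q.card = b), y Q) + η

/-- The feasible region of the outer bound, in the variables `(R, x, y)`. -/
def feasible (H r N : ℕ) (M : ℝ) :
    Set (ℝ × (Finset (User H r) → ℝ) × (Finset (Fin H) → ℝ)) :=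
  {v | PlacementConstraints N M v.2.1 ∧ LoadConstraints v.1 v.2.1 v.2.2 0 ∧
    YConstraints v.2.1 v.2.2 0}

end CombNet

/-! Fix pairwise distinct demands. For a set `A` of library bits and a set `Q` of relays, the joint
entropy of the bits in `A` and the messages `X_Q` is monotone and submodular, and the bits alone
have entropy `|A|`. The argument works with `residual d A Q`, the entropy of `X_Q` given `A`. A user
whose cache lies in `A` and whose relays lie in `Q` can decode its file. By Fano's inequality,
adding that file to `A` then lowers the residual by the number of new bits, up to `fanoBound ε * B`.
Since `fanoBound ε` tends to 0 with `ε`, all errors are small relative to `B`, uniformly in `B`.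

Constraint 2 (`load_bound`): in each block, start from the unconditional entropy of the messages,
which the link loads bound, and decode the users of the block one after another. Then condition all
blocks on everything known to the users in `V`, merge the blocks by subadditivity, and decode the
remaining users of `𝓚_Q`. The residual left over dominates the entropy in `y_Q`, because the latter
conditions on more bits.

Constraint 3 (`sum_bound`): let `T` consist of the bits of the acyclic set of `p` whose coefficient
is positive. Given the other bits, all messages together determine `T`, so the residual of all
relays is almost `|T|`. Han's inequality spreads this over the `b`-element sets `Q`. Passing from
the condition `Tᶜ` to the one used in `y_Q` costs the bits of `T` that are not in `S_Q`. Counting,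
bit by bit, the sets `Q` for which this cost arises leaves at least the coefficient `c`.

Averaging over the distinct demands replaces sub-file sizes by `x` (`sum_chainSumOf`), which gives
(a). For (b), take achievable loads tending to the optimum and schemes with slack tending to 0;
their `x` and `y` stay in a compact set and the constraints are closed
(`exists_feasible_of_tendsto`). For (c), only finitely many instances of the constraints are
non-vacuous, and the same compactness yields the minimum. -/

namespace CombNet

/-! ### Entropy of a partition of a finite uniform probability space -/

section Entropy

variable {Ω : Type} [Fintype Ω]

open Classical in
/-- The number of elements of the class of `w`. -/
noncomputable def classSize (s : Setoid Ω) (w : Ω) : ℕ := (univ.filter fun w' => s w w').card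

/-- The entropy, in bits, of the class of a uniformly distributed element. -/
noncomputable def partEntropy (s : Setoid Ω) : ℝ :=
  (∑ w, Real.logb 2 (Fintype.card Ω / classSize s w)) / Fintype.card Ω

theorem classSize_pos (s : Setoid Ω) (w : Ω) : 0 < classSize s w :=
  card_pos.mpr ⟨w, by simp⟩

theorem classSize_congr (s : Setoid Ω) {w w' : Ω} (h : s w w') :
    classSize s w = classSize s w' := by
  classical
  unfold classSize
  congr 1
  ext z
  simp only [mem_filter, mem_univ, true_and]
  exact ⟨fun hz => s.trans (s.symm h) hz, fun hz => s.trans h hz⟩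

/-- Grouping the sum over outcomes by the value of `X` turns it into the sum over values. Entropies
of variables with different codomains thus become comparable in one lattice of partitions. -/
theorem entropy_eq_partEntropy [Nonempty Ω] {α : Type} [Fintype α] (X : Ω → α) :
    entropy X = partEntropy (Setoid.ker X) := by
  classical
  have hn : (0 : ℝ) < Fintype.card Ω := by exact_mod_cast Fintype.card_pos
  have hc : ∀ w, classSize (Setoid.ker X) w = (univ.filter fun w' : Ω => X w' = X w).card := by
    intro w
    unfold classSize
    congr 1
    ext z
    simp [Setoid.ker_def, eq_comm]
  unfold entropy partEntropy
  rw [← sum_fiberwise univ X fun w => Real.logb 2 (Fintype.card Ω / classSize (Setoid.ker X) w),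
    sum_div, sum_div]
  refine sum_congr rfl fun a _ => ?_
  have h1 : ∀ w ∈ univ.filter fun w : Ω => X w = a,
      Real.logb 2 (Fintype.card Ω / classSize (Setoid.ker X) w) =
        Real.logb 2 (Fintype.card Ω / (univ.filter fun w : Ω => X w = a).card) := by
    intro w hw
    rw [hc w, (mem_filter.mp hw).2]
  rw [sum_congr rfl h1, sum_const, nsmul_eq_mul, Real.negMulLog, Real.logb,
    ← inv_div (Fintype.card Ω : ℝ), Real.log_inv]
  have : Finset.filter (fun w => X w = a) univ = univ.filter (fun w : Ω => X w = a) := by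
    congr
  field_simp

/-- Gibbs' inequality for the conditional entropy of `f` given the class of `u`. -/
theorem partEntropy_inf_ker_le [Nonempty Ω] (u : Setoid Ω) {α : Type} [Fintype α] (f : Ω → α)
    (κ : Ω → α → ℝ) (hu : ∀ w w', u w w' → κ w = κ w') (h0 : ∀ w a, 0 ≤ κ w a)
    (hpos : ∀ w, 0 < κ w (f w)) (hsum : ∀ w, ∑ a, κ w a ≤ 1) :
    partEntropy (u ⊓ Setoid.ker f) ≤
      partEntropy u + (∑ w, -Real.logb 2 (κ w (f w))) / Fintype.card Ω := by
  classical
  have hn : (0 : ℝ) < Fintype.card Ω := by exact_mod_cast Fintype.card_pos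
  have hl2 : (0 : ℝ) < Real.log 2 := Real.log_pos one_lt_two
  set m := u ⊓ Setoid.ker f with hm
  have hcu : ∀ w, (0 : ℝ) < classSize u w := fun w => by exact_mod_cast classSize_pos u w
  have hcm : ∀ w, (0 : ℝ) < classSize m w := fun w => by exact_mod_cast classSize_pos m w
  -- The size of the `u`-class is written as a sum over `w'`, and the two sums are exchanged. For
  -- fixed `w'`, each value `a` then contributes at most `κ w' a`, and these total at most 1.
  have key : ∑ w, κ w (f w) * (classSize u w / classSize m w) ≤ Fintype.card Ω := by
    have e1 : ∀ w, κ w (f w) * ((classSize u w : ℝ) / classSize m w) =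
        ∑ w', if u w w' then κ w (f w) / classSize m w else 0 := by
      intro w
      rw [← sum_filter, sum_const, nsmul_eq_mul]
      unfold classSize
      ring
    rw [sum_congr rfl fun w _ => e1 w, sum_comm]
    have e2 : ∀ w' : Ω, ∑ w, (if u w w' then κ w (f w) / classSize m w else 0) ≤ 1 := by
      intro w'
      refine le_trans ?_ (hsum w')
      rw [← sum_filter, ← sum_fiberwise _ f]
      refine sum_le_sum fun a _ => ?_
      rw [filter_filter]
      have e3 : ∀ w ∈ univ.filter (fun w => u w w' ∧ f w = a),
          κ w (f w) / classSize m w =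
            κ w' a / (univ.filter (fun w => u w w' ∧ f w = a)).card := by
        intro w hw
        obtain ⟨h1, h2⟩ := (mem_filter.mp hw).2
        rw [hu w w' h1, h2]
        congr 2
        unfold classSize
        congr 1
        ext z
        simp only [mem_filter, mem_univ, true_and]
        constructor
        · rintro ⟨h3, h4⟩
          exact ⟨u.trans (u.symm h3) h1, by rw [← h4, h2]⟩
        · rintro ⟨h3, h4⟩
          exact ⟨u.trans h1 (u.symm h3), h2.trans h4.symm⟩
      rw [sum_congr rfl e3, sum_const, nsmul_eq_mul]
      rcases Nat.eq_zero_or_pos (univ.filter (fun w => u w w' ∧ f w = a)).card with h | h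
      · rw [h]; simpa using h0 w' a
      · have : (0 : ℝ) < (univ.filter (fun w => u w w' ∧ f w = a)).card := by exact_mod_cast h
        rw [mul_div_cancel₀ _ this.ne']
    calc _ ≤ ∑ _w' : Ω, (1 : ℝ) := sum_le_sum fun w' _ => e2 w'
      _ = _ := by simp
  -- This is `log t ≤ t - 1` at `t = κ w (f w) * classSize u w / classSize m w`.
  have hterm : ∀ w, Real.logb 2 (Fintype.card Ω / classSize m w) ≤
      Real.logb 2 (Fintype.card Ω / classSize u w) + -Real.logb 2 (κ w (f w)) +
        (κ w (f w) * (classSize u w / classSize m w) - 1) / Real.log 2 := by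
    intro w
    have h1 := Real.log_le_sub_one_of_pos (mul_pos (hpos w) (div_pos (hcu w) (hcm w)))
    rw [Real.log_mul (hpos w).ne' (div_pos (hcu w) (hcm w)).ne',
      Real.log_div (hcu w).ne' (hcm w).ne'] at h1
    unfold Real.logb
    rw [Real.log_div hn.ne' (hcm w).ne', Real.log_div hn.ne' (hcu w).ne', ← neg_div, ← add_div,
      ← add_div]
    apply div_le_div_of_nonneg_right _ hl2.le
    linarith
  unfold partEntropy
  rw [← add_div]
  apply div_le_div_of_nonneg_right _ hn.le
  refine (sum_le_sum fun w _ => hterm w).trans ?_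
  rw [sum_add_distrib, sum_add_distrib, ← sum_div, sum_sub_distrib]
  have : (∑ w, κ w (f w) * ((classSize u w : ℝ) / classSize m w) - ∑ _w : Ω, (1 : ℝ)) / Real.log 2
      ≤ 0 := by
    apply div_nonpos_of_nonpos_of_nonneg _ hl2.le
    simpa using key
  linarith

theorem partEntropy_anti [Nonempty Ω] {s t : Setoid Ω} (h : s ≤ t) :
    partEntropy t ≤ partEntropy s := by
  classical
  unfold partEntropy
  have hn : (0 : ℝ) < Fintype.card Ω := by exact_mod_cast Fintype.card_pos
  refine div_le_div_of_nonneg_right (sum_le_sum fun w _ => ?_) hn.le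
  have hs : (0 : ℝ) < classSize s w := by exact_mod_cast classSize_pos s w
  have ht : (0 : ℝ) < classSize t w := by exact_mod_cast classSize_pos t w
  have hst : (classSize s w : ℝ) ≤ classSize t w := by
    exact_mod_cast card_le_card (monotone_filter_right _ fun z _ hz => h hz)
  exact Real.logb_le_logb_of_le one_lt_two (div_pos hn ht)
    (div_le_div_of_nonneg_left hn.le hs hst)

theorem partEntropy_top [Nonempty Ω] : partEntropy (⊤ : Setoid Ω) = 0 := by
  have hn : (Fintype.card Ω : ℝ) ≠ 0 := by exact_mod_cast Fintype.card_ne_zero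
  have : ∀ w : Ω, classSize (⊤ : Setoid Ω) w = Fintype.card Ω := by
    intro w
    unfold classSize
    simp [Setoid.top_def]
  simp [partEntropy, this, hn]

theorem partEntropy_bot [Nonempty Ω] :
    partEntropy (⊥ : Setoid Ω) = Real.logb 2 (Fintype.card Ω) := by
  have hn : (Fintype.card Ω : ℝ) ≠ 0 := by exact_mod_cast Fintype.card_ne_zero
  have : ∀ w : Ω, classSize (⊥ : Setoid Ω) w = 1 := by
    intro w
    unfold classSize
    exact card_eq_one.mpr ⟨w, by ext z; simp [Setoid.bot_def, eq_comm]⟩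
  simp [partEntropy, this, hn]

/-- Submodularity of entropy. -/
theorem partEntropy_inf_add_le [Nonempty Ω] {a b u : Setoid Ω} (ha : a ≤ u) (hb : b ≤ u) :
    partEntropy (a ⊓ b) + partEntropy u ≤ partEntropy a + partEntropy b := by
  classical
  have hn : (0 : ℝ) < Fintype.card Ω := by exact_mod_cast Fintype.card_pos
  let f : Ω → Quotient b := Quotient.mk b
  have hf : Setoid.ker f = b := Setoid.ker_mk_eq b
  have hcu : ∀ w, (0 : ℝ) < classSize u w := fun w => by exact_mod_cast classSize_pos u w
  have hcb : ∀ w, (0 : ℝ) < classSize b w := fun w => by exact_mod_cast classSize_pos b w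
  -- The true conditional law of the `b`-class given the `u`-class. It is constant on `a`-classes
  -- because `a` refines `u`, so Gibbs' inequality bounds the entropy of `b` given `a` by that of
  -- `b` given `u`.
  let κ : Ω → Quotient b → ℝ := fun w v =>
    ((univ.filter fun w' => u w w' ∧ f w' = v).card : ℝ) / classSize u w
  have hκ : ∀ w, κ w (f w) = classSize b w / classSize u w := by
    intro w
    simp only [κ]
    congr 2
    unfold classSize
    congr 1
    ext z
    simp only [mem_filter, mem_univ, true_and]
    constructor
    · rintro ⟨-, h⟩
      exact b.symm (Quotient.exact h)
    · intro h
      exact ⟨hb h, Quotient.sound (b.symm h)⟩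
  have h := partEntropy_inf_ker_le a f κ ?_ ?_ ?_ ?_
  · rw [hf] at h
    have h2 : (∑ w, -Real.logb 2 (κ w (f w))) / Fintype.card Ω = partEntropy b - partEntropy u := by
      unfold partEntropy
      rw [← sub_div, ← sum_sub_distrib]
      congr 1
      refine sum_congr rfl fun w _ => ?_
      rw [hκ, Real.logb_div (hcb w).ne' (hcu w).ne', Real.logb_div hn.ne' (hcu w).ne',
        Real.logb_div hn.ne' (hcb w).ne']
      ring
    linarith
  · intro w w' hw
    funext v
    simp only [κ]
    rw [classSize_congr u (ha hw)]
    congr 3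
    ext z
    simp only [mem_filter, mem_univ, true_and]
    exact and_congr_left fun _ => ⟨fun h => u.trans (u.symm (ha hw)) h, fun h => u.trans (ha hw) h⟩
  · intro w v
    positivity
  · intro w
    rw [hκ]
    exact div_pos (hcb w) (hcu w)
  · intro w
    simp only [κ]
    rw [← sum_div, div_le_one (hcu w)]
    unfold classSize
    have := card_eq_sum_card_fiberwise (f := f) (s := univ.filter fun w' => u w w') (t := univ)
      (fun _ _ => mem_coe.mpr (mem_univ _))
    rw [this]
    push_cast
    simp [filter_filter]

/-- Gibbs' inequality against the uniform law, over the trivial partition. -/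
theorem partEntropy_ker_le [Nonempty Ω] {α : Type} [Fintype α] (f : Ω → α) :
    partEntropy (Setoid.ker f) ≤ Real.logb 2 (Fintype.card α) := by
  have hn : (0 : ℝ) < Fintype.card Ω := by exact_mod_cast Fintype.card_pos
  have : Nonempty α := ⟨f (Classical.arbitrary Ω)⟩
  have hα : (0 : ℝ) < Fintype.card α := by exact_mod_cast Fintype.card_pos
  have h := partEntropy_inf_ker_le ⊤ f (fun _ _ => (Fintype.card α : ℝ)⁻¹) (fun _ _ _ => rfl)
    (fun _ _ => by positivity) (fun _ => by positivity) (fun _ => by simp [hα.ne'])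
  rw [top_inf_eq, partEntropy_top] at h
  simpa [hn.ne'] using h

/-! ### Fano's inequality. -/

/-- The bound of Fano's inequality, per bit, for the error probability `ε`. -/
noncomputable def fanoBound (ε : ℝ) : ℝ :=
  ε + (Real.negMulLog ε - Real.log (1 - ε)) / Real.log 2

theorem fanoBound_nonneg {ε : ℝ} (h0 : 0 < ε) (h1 : ε < 1) : 0 ≤ fanoBound ε := by
  have := Real.negMulLog_nonneg h0.le h1.le
  have h2 := Real.log_nonpos (by linarith : 0 ≤ 1 - ε) (by linarith)
  have := Real.log_pos one_lt_two
  unfold fanoBound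
  have : 0 ≤ (Real.negMulLog ε - Real.log (1 - ε)) / Real.log 2 := by
    apply div_nonneg <;> linarith
  linarith

/-- `fanoBound` is continuous at 0 and vanishes there. As it does not involve `B`, the error
probability can be fixed before the file size. -/
theorem exists_fanoBound_le {δ : ℝ} (hδ : 0 < δ) : ∃ ε, 0 < ε ∧ ε < 1 ∧ fanoBound ε ≤ δ := by
  have hc : ContinuousAt fanoBound 0 := by
    unfold fanoBound
    have h1 : ContinuousAt (fun ε : ℝ => Real.log (1 - ε)) 0 :=
      ContinuousAt.log (by fun_prop) (by norm_num)
    exact continuousAt_id.add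
      (((Real.continuous_negMulLog.continuousAt).sub h1).div_const _)
  have h0 : fanoBound 0 = 0 := by simp [fanoBound]
  have hev : ∀ᶠ ε in nhds (0 : ℝ), fanoBound ε < δ := by
    have := hc.tendsto
    rw [h0] at this
    exact this.eventually (gt_mem_nhds hδ)
  obtain ⟨ρ, hρ, hb⟩ := Metric.eventually_nhds_iff.mp hev
  refine ⟨min (ρ / 2) (1 / 2), by positivity, ?_, ?_⟩
  · exact lt_of_le_of_lt (min_le_right _ _) (by norm_num)
  · refine (hb ?_).le
    rw [Real.dist_eq, sub_zero, abs_of_pos (by positivity)]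
    exact lt_of_le_of_lt (min_le_left _ _) (by linarith)

open Classical in
/-- Fano's inequality for a variable with `B` bits, estimated by a function of the class of `u`. -/
theorem partEntropy_fano [Nonempty Ω] {B : ℕ} (hB : 1 ≤ B) (u : Setoid Ω) (f g : Ω → (Fin B → Bool))
    (hg : ∀ w w', u w w' → g w = g w') {ε : ℝ} (h0 : 0 < ε) (h1 : ε < 1)
    (herr : ((univ.filter fun w => g w ≠ f w).card : ℝ) / Fintype.card Ω ≤ ε) :
    partEntropy (u ⊓ Setoid.ker f) ≤ partEntropy u + fanoBound ε * B := by
  have hn : (0 : ℝ) < Fintype.card Ω := by exact_mod_cast Fintype.card_pos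
  have hB' : (1 : ℝ) ≤ B := by exact_mod_cast hB
  have hl2 : (0 : ℝ) < Real.log 2 := Real.log_pos one_lt_two
  -- Test law for Gibbs' inequality: weight `1 - ε` on the estimate and `ε / 2 ^ B` on every other
  -- word. A wrong estimate then costs `B - logb 2 ε`.
  let κ : Ω → (Fin B → Bool) → ℝ := fun w a => if a = g w then 1 - ε else ε / 2 ^ B
  have hpos : ∀ w a, 0 < κ w a := by
    intro w a
    simp only [κ]
    split_ifs
    · linarith
    · positivity
  have h := partEntropy_inf_ker_le u f κ (fun w w' hw => by simp only [κ, hg w w' hw])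
    (fun w a => (hpos w a).le) (fun w => hpos w _) ?_
  · refine h.trans (add_le_add_right ?_ _)
    rw [div_le_iff₀ hn]
    have e1 : ∀ w, -Real.logb 2 (κ w (f w)) ≤ -Real.logb 2 (1 - ε) +
        if g w ≠ f w then B - Real.logb 2 ε else 0 := by
      intro w
      have h3 : Real.logb 2 (1 - ε) ≤ 0 :=
        Real.logb_nonpos one_lt_two (by linarith) (by linarith)
      by_cases hw : g w = f w
      · simp [κ, hw]
      · have hw' : ¬ f w = g w := fun h => hw h.symm
        simp only [κ, hw', if_false, ne_eq, hw, not_false_iff, if_true]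
        rw [Real.logb_div h0.ne' (by positivity), Real.logb_pow, Real.logb_self_eq_one one_lt_two]
        linarith
    refine (sum_le_sum fun w _ => e1 w).trans ?_
    rw [sum_add_distrib, ← sum_filter, sum_const, sum_const, nsmul_eq_mul, nsmul_eq_mul, card_univ]
    rw [div_le_iff₀ hn] at herr
    have h4 : Real.logb 2 ε ≤ 0 := Real.logb_nonpos one_lt_two h0.le h1.le
    have h5 : Real.logb 2 (1 - ε) ≤ 0 :=
      Real.logb_nonpos one_lt_two (by linarith) (by linarith)
    have h6 : fanoBound ε = ε - ε * Real.logb 2 ε - Real.logb 2 (1 - ε) := by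
      unfold fanoBound Real.logb Real.negMulLog
      ring
    have h7 : ((univ.filter fun w => g w ≠ f w).card : ℝ) * (B - Real.logb 2 ε) ≤
        ε * Fintype.card Ω * (B - Real.logb 2 ε) :=
      mul_le_mul_of_nonneg_right herr (by linarith)
    -- The terms without a factor `B` are nonnegative, so `1 ≤ B` allows multiplying them by `B`.
    have h8 : (-Real.logb 2 (1 - ε) + ε * (B - Real.logb 2 ε)) ≤ fanoBound ε * B := by
      rw [h6]
      have : 0 ≤ (-(ε * Real.logb 2 ε) - Real.logb 2 (1 - ε)) * (B - 1) := by
        apply mul_nonneg _ (by linarith)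
        have := mul_nonneg h0.le (neg_nonneg.mpr h4)
        linarith
      linarith
    have := mul_le_mul_of_nonneg_right h8 hn.le
    linarith
  · intro w
    have : ∀ a, κ w a ≤ (if a = g w then 1 - ε else 0) + ε / 2 ^ B := by
      intro a
      simp only [κ]
      split_ifs
      · have : 0 ≤ ε / 2 ^ B := by positivity
        linarith
      · simp
    refine (sum_le_sum fun a _ => this a).trans ?_
    rw [sum_add_distrib, sum_ite_eq' univ (g w)]
    simp
    field_simp
    linarith

end Entropy

end CombNet

/-! ### Joint entropies of library bits and relay messages. -/

namespace CombNet

namespace UncodedScheme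

variable {H r N B : ℕ}

/-- Two libraries are related if they agree on the bits in `A` and produce the same messages to the
relays in `Q` for the demands `d`. -/
def knowledge (S : UncodedScheme H r N B) (d : Demand H r N) (A : Finset (Fin N × Fin B))
    (Q : Finset (Fin H)) : Setoid (Library N B) where
  r w w' := (∀ b ∈ A, w b.1 b.2 = w' b.1 b.2) ∧ ∀ h ∈ Q, S.encode d h w = S.encode d h w'
  iseqv := ⟨fun _ => ⟨fun _ _ => rfl, fun _ _ => rfl⟩,
    fun h => ⟨fun b hb => (h.1 b hb).symm, fun k hk => (h.2 k hk).symm⟩,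
    fun h h' => ⟨fun b hb => (h.1 b hb).trans (h'.1 b hb),
      fun k hk => (h.2 k hk).trans (h'.2 k hk)⟩⟩

/-- The joint entropy of the bits in `A` and the messages to the relays in `Q`. -/
noncomputable def jointEntropy (S : UncodedScheme H r N B) (d : Demand H r N)
    (A : Finset (Fin N × Fin B)) (Q : Finset (Fin H)) : ℝ :=
  partEntropy (S.knowledge d A Q)

/-- The entropy of the messages to the relays in `Q` given the bits in `A`. -/
noncomputable def residual (S : UncodedScheme H r N B) (d : Demand H r N)
    (A : Finset (Fin N × Fin B)) (Q : Finset (Fin H)) : ℝ :=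
  S.jointEntropy d A Q - A.card

variable (S : UncodedScheme H r N B) (d : Demand H r N)

theorem knowledge_anti {A A' : Finset (Fin N × Fin B)} {Q Q' : Finset (Fin H)} (hA : A ⊆ A')
    (hQ : Q ⊆ Q') : S.knowledge d A' Q' ≤ S.knowledge d A Q :=
  fun _ _ h => ⟨fun b hb => h.1 b (hA hb), fun k hk => h.2 k (hQ hk)⟩

theorem knowledge_union (A A' : Finset (Fin N × Fin B)) (Q Q' : Finset (Fin H)) :
    S.knowledge d (A ∪ A') (Q ∪ Q') = S.knowledge d A Q ⊓ S.knowledge d A' Q' := by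
  apply le_antisymm
  · exact le_inf (S.knowledge_anti d subset_union_left subset_union_left)
      (S.knowledge_anti d subset_union_right subset_union_right)
  · rintro w w' ⟨h, h'⟩
    exact ⟨fun b hb => (mem_union.mp hb).elim (h.1 b) (h'.1 b),
      fun k hk => (mem_union.mp hk).elim (h.2 k) (h'.2 k)⟩

theorem jointEntropy_mono {A A' : Finset (Fin N × Fin B)} {Q Q' : Finset (Fin H)} (hA : A ⊆ A')
    (hQ : Q ⊆ Q') : S.jointEntropy d A Q ≤ S.jointEntropy d A' Q' :=
  partEntropy_anti (S.knowledge_anti d hA hQ)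

theorem jointEntropy_submod (A A' : Finset (Fin N × Fin B)) (Q Q' : Finset (Fin H)) :
    S.jointEntropy d (A ∪ A') (Q ∪ Q') + S.jointEntropy d (A ∩ A') (Q ∩ Q') ≤
      S.jointEntropy d A Q + S.jointEntropy d A' Q' := by
  unfold jointEntropy
  rw [knowledge_union]
  exact partEntropy_inf_add_le (S.knowledge_anti d inter_subset_left inter_subset_left)
    (S.knowledge_anti d inter_subset_right inter_subset_right)

theorem knowledge_bits_eq (A : Finset (Fin N × Fin B)) :
    S.knowledge d A ∅ =
      Setoid.ker fun (w : Library N B) (b : {b // b ∈ A}) => w b.1.1 b.1.2 := by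
  ext w w'
  constructor
  · rintro ⟨h, -⟩
    exact funext fun b => h b.1 b.2
  · intro h
    exact ⟨fun b hb => congrFun h ⟨b, hb⟩, by simp⟩

theorem jointEntropy_bits_le (A : Finset (Fin N × Fin B)) : S.jointEntropy d A ∅ ≤ A.card := by
  unfold jointEntropy
  rw [knowledge_bits_eq]
  refine (partEntropy_ker_le _).trans ?_
  rw [Fintype.card_fun, Fintype.card_bool, Fintype.card_coe]
  push_cast
  rw [Real.logb_pow, Real.logb_self_eq_one one_lt_two, mul_one]

theorem card_le_jointEntropy_univ (Q : Finset (Fin H)) :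
    ((univ : Finset (Fin N × Fin B)).card : ℝ) ≤ S.jointEntropy d univ Q := by
  refine le_trans ?_ (S.jointEntropy_mono d (subset_refl univ) (empty_subset Q))
  have h : S.knowledge d univ ∅ = ⊥ := by
    rw [eq_bot_iff]
    rintro w w' ⟨h, -⟩
    exact funext fun i => funext fun j => h (i, j) (mem_univ _)
  unfold jointEntropy
  rw [h, partEntropy_bot]
  simp only [Library, Fintype.card_fun, Fintype.card_bool, Fintype.card_fin, card_univ,
    Fintype.card_prod]
  push_cast
  rw [← pow_mul, Real.logb_pow, Real.logb_self_eq_one one_lt_two]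
  push_cast
  linarith

theorem jointEntropy_empty : S.jointEntropy d ∅ ∅ = 0 := by
  unfold jointEntropy
  rw [show S.knowledge d ∅ ∅ = ⊤ from eq_top_iff.mpr fun _ _ _ => ⟨by simp, by simp⟩,
    partEntropy_top]

/-- The lower bound is submodularity for `A` and its complement: the whole library has full entropy,
and the complement contributes at most its size. -/
theorem jointEntropy_bits (A : Finset (Fin N × Fin B)) : S.jointEntropy d A ∅ = A.card := by
  apply le_antisymm (S.jointEntropy_bits_le d A)
  have h1 := S.jointEntropy_submod d A Aᶜ ∅ ∅
  have h2 := S.card_le_jointEntropy_univ d ∅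
  have h3 := S.jointEntropy_bits_le d Aᶜ
  have h4 : (Aᶜ.card : ℝ) = (univ : Finset (Fin N × Fin B)).card - A.card := by
    rw [card_compl, card_univ, Nat.cast_sub (card_le_univ A)]
  rw [union_compl, inter_compl, union_empty, inter_empty, jointEntropy_empty] at h1
  linarith

theorem jointEntropy_messages_le (Q : Finset (Fin H)) :
    S.jointEntropy d ∅ Q ≤ ∑ h ∈ Q, (S.relayBits d h : ℝ) := by
  have h : S.knowledge d ∅ Q = Setoid.ker (S.relayMessages d Q) := by
    ext w w'
    constructor
    · rintro ⟨-, h⟩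
      exact funext fun k => h k.1 k.2
    · intro h
      exact ⟨by simp, fun k hk => congrFun h ⟨k, hk⟩⟩
  unfold jointEntropy
  rw [h]
  refine (partEntropy_ker_le _).trans ?_
  simp only [Fintype.card_pi, Fintype.card_bool, prod_const, card_univ, Fintype.card_fin]
  rw [prod_pow_eq_pow_sum]
  push_cast
  rw [Real.logb_pow, Real.logb_self_eq_one one_lt_two, mul_one]
  push_cast
  rw [univ_eq_attach, sum_attach Q fun h => (S.relayBits d h : ℝ)]

/-- The conditioning sub-files are uniform bits, so their entropy is their number. This links
`yPerm` to `residual`. -/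
theorem condEntropy_eq_residual (Q : Finset (Fin H)) (T : Finset (Fin N × Finset (User H r))) :
    condEntropy (S.relayMessages d Q) (S.otherSubfiles T) =
      S.residual d (univ.filter fun b => (b.1, S.owners b) ∉ T) Q := by
  unfold condEntropy residual
  rw [← S.jointEntropy_bits d, entropy_eq_partEntropy, entropy_eq_partEntropy]
  unfold jointEntropy
  congr 2
  · ext w w'
    constructor
    · intro h
      obtain ⟨h1, h2⟩ := Prod.ext_iff.mp h
      exact ⟨fun b hb => congrFun h2 ⟨b, (mem_filter.mp hb).2⟩, fun k hk => congrFun h1 ⟨k, hk⟩⟩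
    · rintro ⟨h1, h2⟩
      exact Prod.ext (funext fun k => h2 k.1 k.2)
        (funext fun b => h1 b.1 (mem_filter.mpr ⟨mem_univ _, b.2⟩))
  · rw [knowledge_bits_eq]
    ext w w'
    constructor
    · intro h
      exact funext fun b => congrFun h ⟨b.1, (mem_filter.mp b.2).2⟩
    · intro h
      exact funext fun b => congrFun h ⟨b.1, mem_filter.mpr ⟨mem_univ _, b.2⟩⟩

/-! ### Conditional entropies of the messages -/

/-- Conditioning on more reduces entropy: submodularity for the pairs `(A, Q)` and `(A', ∅)`. -/
theorem residual_anti {A A' : Finset (Fin N × Fin B)} (hA : A ⊆ A') (Q : Finset (Fin H)) :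
    S.residual d A' Q ≤ S.residual d A Q := by
  have h := S.jointEntropy_submod d A A' Q ∅
  rw [union_eq_right.mpr hA, inter_eq_left.mpr hA, union_empty, inter_empty, jointEntropy_bits,
    jointEntropy_bits] at h
  unfold residual
  linarith

/-- Conversely, each additional conditioning bit lowers the entropy by at most one bit. -/
theorem residual_le_add_card (A C : Finset (Fin N × Fin B)) (Q : Finset (Fin H)) :
    S.residual d A Q ≤ S.residual d (A ∪ C) Q + (C \ A).card := by
  have h := S.jointEntropy_mono d (subset_union_left (s₁ := A) (s₂ := C)) (subset_refl Q)
  have h2 : ((A ∪ C).card : ℝ) = A.card + (C \ A).card := by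
    rw [← union_sdiff_self_eq_union, card_union_of_disjoint disjoint_sdiff]
    push_cast
    rfl
  unfold residual
  linarith

theorem residual_submod (A : Finset (Fin N × Fin B)) (Q Q' : Finset (Fin H)) :
    S.residual d A (Q ∪ Q') + S.residual d A (Q ∩ Q') ≤ S.residual d A Q + S.residual d A Q' := by
  have h := S.jointEntropy_submod d A A Q Q'
  rw [union_self, inter_self] at h
  unfold residual
  linarith

theorem residual_empty (A : Finset (Fin N × Fin B)) : S.residual d A ∅ = 0 := by
  unfold residual
  rw [jointEntropy_bits, sub_self]

theorem residual_nonneg (A : Finset (Fin N × Fin B)) (Q : Finset (Fin H)) :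
    0 ≤ S.residual d A Q := by
  have h := S.jointEntropy_mono d (subset_refl A) (empty_subset Q)
  rw [jointEntropy_bits] at h
  unfold residual
  linarith

theorem residual_messages_le (Q : Finset (Fin H)) :
    S.residual d ∅ Q ≤ ∑ h ∈ Q, (S.relayBits d h : ℝ) := by
  have := S.jointEntropy_messages_le d Q
  simpa [residual] using this

/-- Subadditivity over a disjoint union of sets of relays. -/
theorem residual_biUnion_le {ι : Type} [DecidableEq ι] (A : Finset (Fin N × Fin B)) (s : Finset ι)
    (P : ι → Finset (Fin H)) : S.residual d A (s.biUnion P) ≤ ∑ i ∈ s, S.residual d A (P i) := by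
  induction s using Finset.induction_on with
  | empty => simp [residual_empty]
  | insert i s hi ih =>
    rw [biUnion_insert, sum_insert hi]
    have := S.residual_submod d A (P i) (s.biUnion P)
    have := S.residual_nonneg d A (P i ∩ s.biUnion P)
    linarith

/-! ### Decoding -/

/-- The bits of file `i`. -/
def fileBits (N B : ℕ) (i : Fin N) : Finset (Fin N × Fin B) := univ.filter fun b => b.1 = i

/-- The estimate depends only on the cache and on what the relays of `k` received, so Fano's
inequality applies to the partition they generate. -/
theorem jointEntropy_cache_union_file_le (hB : 1 ≤ B) {ε : ℝ} (h0 : 0 < ε) (h1 : ε < 1)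
    (herr : S.ErrorAtMost ε) (k : User H r) :
    S.jointEntropy d (S.cache k ∪ fileBits N B (d k)) k.1 ≤
      S.jointEntropy d (S.cache k) k.1 + fanoBound ε * B := by
  classical
  have h := partEntropy_fano hB (S.knowledge d (S.cache k) k.1) (fun w : Library N B => w (d k))
    (S.estimate d k) ?_ h0 h1 ?_
  · refine le_trans (le_of_eq ?_) h
    unfold jointEntropy
    congr 1
    ext w w'
    constructor
    · rintro ⟨h2, h3⟩
      refine ⟨⟨fun b hb => h2 b (mem_union_left _ hb), h3⟩, funext fun j => ?_⟩
      exact h2 (d k, j) (mem_union_right _ (by simp [fileBits]))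
    · rintro ⟨⟨h2, h3⟩, h4⟩
      refine ⟨fun b hb => ?_, h3⟩
      rcases mem_union.mp hb with hb | hb
      · exact h2 b hb
      · have : b.1 = d k := by simpa [fileBits] using hb
        rw [this]
        exact congrFun h4 b.2
  · rintro w w' ⟨h2, h3⟩
    unfold estimate
    congr 1
    · exact funext fun b => h2 b.1 b.2
    · exact funext fun h => by rw [h3 h.1 h.2]
  · refine le_trans (le_of_eq ?_) (herr d k)
    congr!

/-- Extra knowledge cannot hurt: submodularity carries the bound from the cache and relays of `k` to
any larger `A` and `Q`. -/
theorem jointEntropy_union_file_le (hB : 1 ≤ B) {ε : ℝ} (h0 : 0 < ε) (h1 : ε < 1)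
    (herr : S.ErrorAtMost ε) {k : User H r} {A : Finset (Fin N × Fin B)} {Q : Finset (Fin H)}
    (hA : S.cache k ⊆ A) (hQ : k.1 ⊆ Q) :
    S.jointEntropy d (A ∪ fileBits N B (d k)) Q ≤ S.jointEntropy d A Q + fanoBound ε * B := by
  have h := S.jointEntropy_submod d A (S.cache k ∪ fileBits N B (d k)) Q k.1
  have h2 := S.jointEntropy_cache_union_file_le d hB h0 h1 herr k
  have h3 := S.jointEntropy_mono d (subset_inter hA (subset_union_left (s₂ := fileBits N B (d k))))
    (subset_inter hQ (subset_refl k.1))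
  rw [← union_assoc, union_eq_left.mpr hA, union_eq_left.mpr hQ] at h
  linarith

theorem residual_union_file_add_card_le (hB : 1 ≤ B) {ε : ℝ} (h0 : 0 < ε) (h1 : ε < 1)
    (herr : S.ErrorAtMost ε) {k : User H r} {A : Finset (Fin N × Fin B)} {Q : Finset (Fin H)}
    (hA : S.cache k ⊆ A) (hQ : k.1 ⊆ Q) :
    S.residual d (A ∪ fileBits N B (d k)) Q + (fileBits N B (d k) \ A).card ≤
      S.residual d A Q + fanoBound ε * B := by
  have h := S.jointEntropy_union_file_le d hB h0 h1 herr hA hQ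
  have h2 : ((A ∪ fileBits N B (d k)).card : ℝ) = A.card + (fileBits N B (d k) \ A).card := by
    rw [← union_sdiff_self_eq_union, card_union_of_disjoint disjoint_sdiff]
    push_cast
    rfl
  unfold residual
  linarith

/-- Han's inequality: the sum over all `b`-element sets of relays. -/
theorem choose_mul_residual_le (A : Finset (Fin N × Fin B)) {b : ℕ} (hb : 1 ≤ b) :
    ((H - 1).choose (b - 1) : ℝ) * S.residual d A univ ≤
      ∑ Q ∈ univ.filter (fun Q : Finset (Fin H) => Q.card = b), S.residual d A Q := by
  classical
  -- Chain rule along the order of the relays: `inc h` is the entropy of `X_h` given `A` and the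
  -- earlier messages. Within a subset `Q` fewer messages precede `h`, whence `key`; each relay lies
  -- in `(H - 1).choose (b - 1)` of the `b`-element sets.
  let inc : Fin H → ℝ := fun h => S.residual d A (Iic h) - S.residual d A (Iio h)
  have hinc : ∀ h : Fin H, insert h (Iio h) = Iic h := fun h => by
    ext x
    simp [le_iff_eq_or_lt]
  have key : ∀ Q : Finset (Fin H), ∑ h ∈ Q, inc h ≤ S.residual d A Q := by
    intro Q
    induction Q using Finset.induction_on_max with
    | empty => simp [residual_empty]
    | insert a s hs ih =>
      have ha : a ∉ s := fun h => lt_irrefl _ (hs a h)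
      rw [sum_insert ha]
      have hsub : s ⊆ Iio a := fun x hx => mem_Iio.mpr (hs x hx)
      have h := S.residual_submod d A (Iio a) (insert a s)
      have e1 : Iio a ∪ insert a s = Iic a := by
        rw [union_insert, union_eq_left.mpr hsub, hinc]
      have e2 : Iio a ∩ insert a s = s := by
        rw [inter_insert_of_notMem (by simp), inter_eq_right.mpr hsub]
      rw [e1, e2] at h
      simp only [inc]
      linarith
  have hfull : ∑ h, inc h = S.residual d A univ := by
    have gen : ∀ n : ℕ, n ≤ H →
        ∑ h ∈ univ.filter (fun h : Fin H => h.1 < n), inc h =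
          S.residual d A (univ.filter fun h : Fin H => h.1 < n) := by
      intro n
      induction n with
      | zero => intro _; simp [residual_empty]
      | succ n ih =>
        intro hn
        have e : univ.filter (fun h : Fin H => h.1 < n + 1) =
            insert ⟨n, hn⟩ (univ.filter fun h : Fin H => h.1 < n) := by
          ext h
          simp only [mem_filter, mem_univ, true_and, mem_insert, Fin.ext_iff]
          omega
        have e1 : Iio (⟨n, hn⟩ : Fin H) = univ.filter fun h : Fin H => h.1 < n := by
          ext h
          simp [Fin.lt_def]
        rw [e, sum_insert (by simp), ih (by omega)]
        simp only [inc]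
        rw [← hinc, e1]
        ring
    have := gen H le_rfl
    simpa using this
  have hcount : ∀ h : Fin H,
      ((univ.filter fun Q : Finset (Fin H) => Q.card = b).filter fun Q => h ∈ Q).card =
        (H - 1).choose (b - 1) := by
    intro h
    have e : ((univ.filter fun Q : Finset (Fin H) => Q.card = b).filter fun Q => h ∈ Q) =
        ((univ.erase h).powersetCard (b - 1)).image (insert h) := by
      ext Q
      simp only [mem_filter, mem_univ, true_and, mem_image, mem_powersetCard]
      constructor
      · rintro ⟨h1, h2⟩
        exact ⟨Q.erase h, ⟨erase_subset_erase _ (subset_univ _), by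
          rw [card_erase_of_mem h2, h1]⟩, insert_erase h2⟩
      · rintro ⟨T, ⟨h1, h2⟩, rfl⟩
        have : h ∉ T := fun hT => by simpa using h1 hT
        exact ⟨by rw [card_insert_of_notMem this]; omega, mem_insert_self _ _⟩
    rw [e, card_image_of_injOn, card_powersetCard, card_erase_of_mem (mem_univ h), card_univ,
      Fintype.card_fin]
    intro T hT T' hT' hTT
    have h1 : h ∉ T := fun hh => by simpa using (mem_powersetCard.mp (mem_coe.mp hT)).1 hh
    have h2 : h ∉ T' := fun hh => by simpa using (mem_powersetCard.mp (mem_coe.mp hT')).1 hh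
    rw [← erase_insert h1, ← erase_insert h2]
    exact congrArg (fun s => s.erase h) hTT
  calc ((H - 1).choose (b - 1) : ℝ) * S.residual d A univ
      = ∑ h, ((H - 1).choose (b - 1) : ℝ) * inc h := by rw [← hfull, mul_sum]
    _ = ∑ h, ∑ Q ∈ univ.filter (fun Q : Finset (Fin H) => Q.card = b),
          if h ∈ Q then inc h else 0 := by
        refine sum_congr rfl fun h _ => ?_
        rw [← sum_filter, sum_const, hcount, nsmul_eq_mul]
    _ = ∑ Q ∈ univ.filter (fun Q : Finset (Fin H) => Q.card = b), ∑ h ∈ Q, inc h := by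
        rw [sum_comm]
        refine sum_congr rfl fun Q _ => ?_
        rw [← sum_filter]
        congr 1
        ext h
        simp
    _ ≤ _ := sum_le_sum fun Q _ => key Q

end UncodedScheme

end CombNet

namespace CombNet

variable {H r N B : ℕ}

/-! ### Sums along a chain of users -/

/-- `∑_{j ∈ [|v|]} ∑_{W ⊆ A \ {v_1, …, v_j}} g v_j W`. -/
def chainSumOf (g : User H r → Finset (User H r) → ℝ) (A : Finset (User H r))
    (v : List (User H r)) : ℝ :=
  ∑ j : Fin v.length, ∑ W ∈ (A \ (v.take (j + 1)).toFinset).powerset, g (v.get j) W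

theorem chainSumOf_nil (g : User H r → Finset (User H r) → ℝ) (A : Finset (User H r)) :
    chainSumOf g A [] = 0 := by
  simp [chainSumOf]

theorem sdiff_take_succ_cons (A : Finset (User H r)) (k : User H r) (v : List (User H r)) (n : ℕ) :
    A \ ((k :: v).take (n + 1)).toFinset = (A \ {k}) \ (v.take n).toFinset := by
  ext z
  simp only [List.take_succ_cons, List.toFinset_cons, mem_sdiff, mem_insert, mem_singleton]
  tauto

/-- Peeling off the first user moves it into the excluded set. Together with `mem_acyclicSet_cons`
this drives the inductions along a chain. -/
theorem chainSumOf_cons (g : User H r → Finset (User H r) → ℝ) (A : Finset (User H r))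
    (k : User H r) (v : List (User H r)) :
    chainSumOf g A (k :: v) = ∑ W ∈ (A \ {k}).powerset, g k W + chainSumOf g (A \ {k}) v := by
  unfold chainSumOf
  rw [← Equiv.sum_comp (finCongr (List.length_cons (a := k) (as := v)).symm), Fin.sum_univ_succ]
  congr 1
  refine sum_congr rfl fun j _ => ?_
  simp only [finCongr_apply, Fin.val_cast, Fin.val_succ]
  rw [sdiff_take_succ_cons]
  rfl

theorem mem_acyclicSet_nil (d : Demand H r N) (A : Finset (User H r))
    (t : Fin N × Finset (User H r)) : t ∉ acyclicSet d A [] := by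
  simp [acyclicSet]

theorem mem_acyclicSet_cons (d : Demand H r N) (A : Finset (User H r)) (k : User H r)
    (v : List (User H r)) (t : Fin N × Finset (User H r)) :
    t ∈ acyclicSet d A (k :: v) ↔
      (t.1 = d k ∧ t.2 ⊆ A \ {k}) ∨ t ∈ acyclicSet d (A \ {k}) v := by
  obtain ⟨i, W⟩ := t
  have hm : ∀ A v, (i, W) ∈ acyclicSet d A v ↔
      ∃ j : Fin v.length, i = d (v.get j) ∧ W ⊆ A \ (v.take (j + 1)).toFinset := by
    intro A v
    simp only [acyclicSet, mem_biUnion, mem_univ, true_and, mem_image, mem_powerset, Prod.mk.injEq]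
    constructor
    · rintro ⟨j, W', h, rfl, rfl⟩
      exact ⟨j, rfl, h⟩
    · rintro ⟨j, rfl, h⟩
      exact ⟨j, W, h, rfl, rfl⟩
  rw [hm, hm, ← (finCongr (List.length_cons (a := k) (as := v)).symm).exists_congr_right,
    Fin.exists_fin_succ]
  simp only [finCongr_apply, Fin.val_cast, Fin.val_succ, sdiff_take_succ_cons, Fin.val_zero, List.take_zero,
    List.toFinset_nil, sdiff_empty]
  rfl

theorem exists_of_mem_acyclicSet {d : Demand H r N} {A : Finset (User H r)} {v : List (User H r)}
    {t : Fin N × Finset (User H r)} (h : t ∈ acyclicSet d A v) :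
    ∃ k ∈ v, t.1 = d k ∧ t.2 ⊆ A := by
  induction v generalizing A with
  | nil => exact absurd h (mem_acyclicSet_nil d A t)
  | cons k v ih =>
    rcases (mem_acyclicSet_cons d A k v t).mp h with ⟨h1, h2⟩ | h
    · exact ⟨k, by simp, h1, h2.trans sdiff_subset⟩
    · obtain ⟨k', h1, h2, h3⟩ := ih h
      exact ⟨k', by simp [h1], h2, h3.trans sdiff_subset⟩

/-- Deleting the users in `U` from the list leaves `k` with no new predecessors, and `W` avoids `U`,
so it survives the shrinking of `A`. This compares the acyclic set of `p` with the sets `S_Q`. -/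
theorem mem_acyclicSet_filter {d : Demand H r N} (hd : Function.Injective d)
    (U : Finset (User H r)) {A : Finset (User H r)} {v : List (User H r)} {k : User H r}
    {W : Finset (User H r)} (h : (d k, W) ∈ acyclicSet d A v) (hk : k ∉ U) (hW : Disjoint W U) :
    (d k, W) ∈ acyclicSet d (A \ U) (v.filter fun k => k ∈ univ \ U) := by
  induction v generalizing A with
  | nil => exact absurd h (mem_acyclicSet_nil d A _)
  | cons k' v ih =>
    by_cases hk' : k' ∈ U
    · have e : (A \ {k'}) \ U = A \ U := by
        ext z
        simp only [mem_sdiff, mem_singleton]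
        constructor
        · tauto
        · rintro ⟨h1, h2⟩
          exact ⟨⟨h1, fun h => h2 (h ▸ hk')⟩, h2⟩
      rw [List.filter_cons_of_neg (by simpa using hk')]
      rcases (mem_acyclicSet_cons d A k' v _).mp h with ⟨h1, -⟩ | h
      · exact absurd (hd h1 ▸ hk') hk
      · have := ih h
        rwa [e] at this
    · rw [List.filter_cons_of_pos (by simpa using hk'), mem_acyclicSet_cons]
      have e : (A \ U) \ {k'} = (A \ {k'}) \ U := sdiff_right_comm A U {k'}
      rw [e]
      rcases (mem_acyclicSet_cons d A k' v _).mp h with ⟨h1, h2⟩ | h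
      · exact Or.inl ⟨h1, fun z hz => mem_sdiff.mpr ⟨h2 hz, disjoint_left.mp hW hz⟩⟩
      · exact Or.inr (ih h)

/-! ### Acyclic sets of bits and successive decoding. -/

namespace UncodedScheme

variable (S : UncodedScheme H r N B) (d : Demand H r N)

theorem sum_mul_subfileSize (f : Finset (User H r) → ℝ) (i : Fin N)
    (P : Finset (Finset (User H r))) :
    ∑ W ∈ P, f W * S.subfileSize i W =
      ∑ b ∈ univ.filter (fun b : Fin N × Fin B => b.1 = i ∧ S.owners b ∈ P), f (S.owners b) := by
  have e : univ.filter (fun b : Fin N × Fin B => b.1 = i ∧ S.owners b ∈ P) =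
      P.biUnion fun W => (univ.filter fun j : Fin B => S.owners (i, j) = W).image fun j => (i, j) := by
    ext ⟨i', j⟩
    simp only [mem_filter, mem_univ, true_and, mem_biUnion, mem_image, Prod.mk.injEq]
    constructor
    · rintro ⟨rfl, h⟩
      exact ⟨_, h, j, rfl, rfl, rfl⟩
    · rintro ⟨W, h, j', rfl, rfl, rfl⟩
      exact ⟨rfl, h⟩
  rw [e, sum_biUnion]
  · refine sum_congr rfl fun W _ => ?_
    rw [sum_image (by simp), sum_congr rfl (g := fun _ => f W), sum_const, nsmul_eq_mul, mul_comm]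
    · rfl
    · intro j hj
      rw [(mem_filter.mp hj).2]
  · intro W _ W' _ hW
    rw [Function.onFun, disjoint_left]
    intro b hb hb'
    obtain ⟨j, hj, rfl⟩ := mem_image.mp hb
    obtain ⟨j', hj', h⟩ := mem_image.mp hb'
    have : j' = j := (Prod.mk.inj h).2
    subst this
    exact hW ((mem_filter.mp hj).2.symm.trans (mem_filter.mp hj').2)

/-- With distinct demands, different users of the chain refer to different files, so every bit of
the acyclic set is counted exactly once. -/
theorem chainSumOf_mul_subfileSize {d : Demand H r N} (hd : Function.Injective d)
    (f : Fin N → Finset (User H r) → ℝ) (A : Finset (User H r)) {v : List (User H r)}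
    (hv : v.Nodup) :
    chainSumOf (fun k W => f (d k) W * S.subfileSize (d k) W) A v =
      ∑ b ∈ univ.filter (fun b : Fin N × Fin B => (b.1, S.owners b) ∈ acyclicSet d A v),
        f b.1 (S.owners b) := by
  induction v generalizing A with
  | nil => simp [chainSumOf_nil, mem_acyclicSet_nil]
  | cons k v ih =>
    obtain ⟨hk, hv⟩ := List.nodup_cons.mp hv
    rw [chainSumOf_cons, ih _ hv, sum_mul_subfileSize]
    simp only [mem_acyclicSet_cons, filter_or]
    rw [sum_union]
    · congr 1
      refine sum_congr (by simp) fun b hb => ?_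
      rw [(mem_filter.mp hb).2.1]
    · rw [disjoint_left]
      intro b hb hb'
      obtain ⟨k', h1, h2, -⟩ := exists_of_mem_acyclicSet (mem_filter.mp hb').2
      have := hd (h2.symm.trans (mem_filter.mp hb).2.1)
      exact hk (this ▸ h1)

/-- The bits of the files demanded by the users in `U` and the bits stored by these users. -/
def knownBits (U : Finset (User H r)) : Finset (Fin N × Fin B) :=
  univ.filter fun b => b.1 ∈ U.image d ∨ ¬ Disjoint (S.owners b) U

theorem mem_owners {k : User H r} {b : Fin N × Fin B} : k ∈ S.owners b ↔ b ∈ S.cache k := by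
  simp [owners]

theorem knownBits_mono {U U' : Finset (User H r)} (h : U ⊆ U') :
    S.knownBits d U ⊆ S.knownBits d U' := by
  refine monotone_filter_right _ fun b _ hb => hb.imp (fun hb => image_subset_image h hb) ?_
  exact fun hb hd => hb (hd.mono_right h)

theorem knownBits_empty : S.knownBits d ∅ = ∅ := by
  simp [knownBits]

theorem knownBits_insert (U : Finset (User H r)) (k : User H r) :
    S.knownBits d (insert k U) = S.knownBits d U ∪ S.cache k ∪ fileBits N B (d k) := by
  ext b
  simp only [knownBits, fileBits, mem_filter, mem_univ, true_and, mem_union, image_insert,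
    mem_insert, disjoint_insert_right, mem_owners]
  tauto

/-- The next user `k` first receives its cache, which can only lower the residual, and then decodes
its file. Bits of that file stored only outside `insert k U` are new, since nobody in `U` demands
the file. The bounds telescope along `v`. -/
theorem chainSumOf_add_residual_le (hB : 1 ≤ B) {ε : ℝ} (h0 : 0 < ε) (h1 : ε < 1)
    (herr : S.ErrorAtMost ε) {d : Demand H r N} (hd : Function.Injective d) {Q : Finset (Fin H)}
    {v : List (User H r)} (hv : v.Nodup) (hvQ : ∀ k ∈ v, k.1 ⊆ Q) {U : Finset (User H r)}
    (hU : ∀ k ∈ v, k ∉ U) :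
    chainSumOf (fun k W => S.subfileSize (d k) W) (univ \ U) v +
      S.residual d (S.knownBits d (U ∪ v.toFinset)) Q ≤
      S.residual d (S.knownBits d U) Q + v.length * (fanoBound ε * B) := by
  induction v generalizing U with
  | nil => simp [chainSumOf_nil]
  | cons k v ih =>
    obtain ⟨hk, hv⟩ := List.nodup_cons.mp hv
    have ih := ih hv (fun z hz => hvQ z (by simp [hz])) (U := insert k U) (by
      intro z hz hzU
      rcases mem_insert.mp hzU with h | h
      · exact hk (h ▸ hz)
      · exact hU z (by simp [hz]) h)
    have e1 : (univ \ U) \ {k} = univ \ insert k U := by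
      ext z
      simp only [mem_sdiff, mem_univ, true_and, mem_singleton, mem_insert]
      tauto
    have e2 : U ∪ (k :: v).toFinset = insert k U ∪ v.toFinset := by
      ext z
      simp only [List.toFinset_cons, mem_union, mem_insert]
      tauto
    rw [chainSumOf_cons, e1, e2]
    have h2 := S.residual_union_file_add_card_le d hB h0 h1 herr (k := k)
      (A := S.knownBits d U ∪ S.cache k) subset_union_right (hvQ k (by simp))
    rw [← knownBits_insert] at h2
    have h3 := S.residual_anti d (subset_union_left (s₁ := S.knownBits d U) (s₂ := S.cache k)) Q
    have h4 : ∑ W ∈ (univ \ insert k U).powerset, (S.subfileSize (d k) W : ℝ) ≤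
        (fileBits N B (d k) \ (S.knownBits d U ∪ S.cache k)).card := by
      have := S.sum_mul_subfileSize (fun _ => 1) (d k) (univ \ insert k U).powerset
      simp only [one_mul, sum_const, nsmul_eq_mul, mul_one] at this
      rw [this]
      refine Nat.cast_le.mpr (card_le_card fun b hb => ?_)
      obtain ⟨hb1, hb2⟩ := (mem_filter.mp hb).2
      rw [mem_powerset, subset_sdiff] at hb2
      obtain ⟨h5, h6⟩ := disjoint_insert_right.mp hb2.2
      simp only [mem_sdiff, mem_union, fileBits, knownBits, mem_filter, mem_univ, true_and,
        not_or, not_not]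
      refine ⟨hb1, ⟨?_, h6⟩, fun h => h5 (S.mem_owners.mpr h)⟩
      rw [hb1, mem_image]
      rintro ⟨z, hz, hzk⟩
      exact hU k (by simp) (hd hzk ▸ hz)
    rw [List.length_cons]
    push_cast
    linarith

/-- The messages to all relays determine all bits up to the errors, if the unknown bits form an
acyclic set. -/
theorem jointEntropy_univ_le_of_acyclic (hB : 1 ≤ B) {ε : ℝ} (h0 : 0 < ε) (h1 : ε < 1)
    (herr : S.ErrorAtMost ε) (A : Finset (User H r)) (v : List (User H r))
    (C : Finset (Fin N × Fin B))
    (hC : ∀ b, b ∉ C → (b.1, S.owners b) ∈ acyclicSet d A v) :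
    S.jointEntropy d univ univ ≤ S.jointEntropy d C univ + v.length * (fanoBound ε * B) := by
  induction v generalizing A C with
  | nil =>
    have : C = univ := eq_univ_of_forall fun b =>
      by_contra fun hb => mem_acyclicSet_nil d A _ (hC b hb)
    simp [this]
  | cons k v ih =>
    -- Acyclicity: no unknown bit is stored by the first user of the list, so its whole cache is
    -- known. Once its file is decoded, the rest is acyclic for the tail.
    have hk : S.cache k ⊆ C := by
      intro b hb
      by_contra hbC
      have : S.owners b ⊆ A \ {k} := by
        rcases (mem_acyclicSet_cons d A k v _).mp (hC b hbC) with ⟨-, h⟩ | h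
        · exact h
        · obtain ⟨_, -, -, h⟩ := exists_of_mem_acyclicSet h
          exact h
      simpa using this (S.mem_owners.mpr hb)
    have h2 := S.jointEntropy_union_file_le d hB h0 h1 herr hk (subset_univ k.1)
    have h3 := ih (A \ {k}) (C ∪ fileBits N B (d k)) (by
      intro b hb
      rw [mem_union, not_or] at hb
      rcases (mem_acyclicSet_cons d A k v _).mp (hC b hb.1) with ⟨h, -⟩ | h
      · exact absurd (by simpa [fileBits] using h) hb.2
      · exact h)
    rw [List.length_cons]
    push_cast
    linarith

/-! ### The bounds for a fixed vector of distinct demands -/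

theorem length_le_of_nodup {v : List (User H r)} (hv : v.Nodup) :
    (v.length : ℝ) ≤ Fintype.card (User H r) := by
  rw [← List.toFinset_card_of_nodup hv]
  exact_mod_cast card_le_univ _

theorem load_bound (hB : 1 ≤ B) {ε : ℝ} (h0 : 0 < ε) (h1 : ε < 1)
    (herr : S.ErrorAtMost ε) {R : ℝ} (hR : S.LoadAtMost R) {d : Demand H r N}
    (hd : Function.Injective d) (Q : Finset (Fin H)) (a : ℕ) (ha : a ≤ Q.card / r)
    (P : Fin a → Finset (Fin H)) (hPd : ∀ i j, i ≠ j → Disjoint (P i) (P j))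
    (hPQ : univ.biUnion P = Q) (p : Fin a → List (User H r))
    (hp : ∀ i, IsPermOf (usersWithin r (P i)) (p i)) (V : Finset (User H r))
    (hV : V = univ.biUnion fun i => usersWithin r (P i)) (q : List (User H r))
    (hq : IsPermOf (usersWithin r Q \ V) q) (p₀ : List (User H r)) :
    (∑ i, chainSumOf (fun k W => (S.subfileSize (d k) W : ℝ)) univ (p i)) +
      chainSumOf (fun k W => (S.subfileSize (d k) W : ℝ)) (univ \ V) q +
      condEntropy (S.relayMessages d Q)
        (S.otherSubfiles (acyclicSet d (univ \ usersWithin r Q)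
          (p₀.filter fun k => k ∈ univ \ usersWithin r Q))) ≤
      Q.card * R * B + (H + 1) * Fintype.card (User H r) * fanoBound ε * B := by
  have hδ : 0 ≤ fanoBound ε * B := mul_nonneg (fanoBound_nonneg h0 h1) (Nat.cast_nonneg _)
  have hmem : ∀ (J : Finset (Fin H)) (k : User H r), k ∈ usersWithin r J ↔ k.1 ⊆ J :=
    fun J k => by simp [usersWithin]
  have hVQ : V ⊆ usersWithin r Q := by
    intro k hk
    rw [hV] at hk
    obtain ⟨i, -, hi⟩ := mem_biUnion.mp hk
    rw [hmem] at hi ⊢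
    exact hi.trans (hPQ ▸ subset_biUnion_of_mem P (mem_univ i))
  have hpk : ∀ i, ∀ k ∈ p i, k.1 ⊆ P i := by
    intro i k hk
    rw [← hmem, ← (hp i).2]
    exact List.mem_toFinset.mpr hk
  have hqk : ∀ k ∈ q, k.1 ⊆ Q ∧ k ∉ V := by
    intro k hk
    have := List.mem_toFinset.mpr hk
    rw [hq.2, mem_sdiff, hmem] at this
    exact this
  -- the messages to the relays
  have h2 : ∑ i, S.residual d ∅ (P i) ≤ Q.card * R * B := by
    calc ∑ i, S.residual d ∅ (P i) ≤ ∑ i, ∑ h ∈ P i, (S.relayBits d h : ℝ) :=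
          sum_le_sum fun i _ => S.residual_messages_le d (P i)
      _ = ∑ h ∈ Q, (S.relayBits d h : ℝ) := by
          rw [← hPQ, sum_biUnion fun i _ j _ hij => hPd i j hij]
      _ ≤ ∑ _h ∈ Q, R * B := sum_le_sum fun h _ => hR.1 d h
      _ = Q.card * R * B := by rw [sum_const, nsmul_eq_mul, mul_assoc]
  -- the users of the blocks
  have h3 : ∀ i, chainSumOf (fun k W => (S.subfileSize (d k) W : ℝ)) univ (p i) +
      S.residual d (S.knownBits d V) (P i) ≤
      S.residual d ∅ (P i) + Fintype.card (User H r) * (fanoBound ε * B) := by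
    intro i
    have h := S.chainSumOf_add_residual_le hB h0 h1 herr hd (hp i).1 (hpk i) (U := ∅) (by simp)
    rw [knownBits_empty, sdiff_empty, empty_union, (hp i).2] at h
    have h4 := S.residual_anti d (S.knownBits_mono d (U := usersWithin r (P i)) (U' := V)
      (by rw [hV]; exact subset_biUnion_of_mem (fun i => usersWithin r (P i)) (mem_univ i))) (P i)
    have := mul_le_mul_of_nonneg_right (length_le_of_nodup (hp i).1) hδ
    linarith
  have h4 := sum_le_sum fun i (_ : i ∈ (univ : Finset (Fin a))) => h3 i
  rw [sum_add_distrib, sum_add_distrib, sum_const, card_univ, Fintype.card_fin,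
    nsmul_eq_mul] at h4
  have h5 := S.residual_biUnion_le d (S.knownBits d V) univ P
  rw [hPQ] at h5
  -- the remaining users
  have h6 := S.chainSumOf_add_residual_le hB h0 h1 herr hd hq.1 (fun k hk => (hqk k hk).1)
    (fun k hk => (hqk k hk).2)
  rw [hq.2, union_sdiff_of_subset hVQ] at h6
  have h7 := mul_le_mul_of_nonneg_right (length_le_of_nodup hq.1) hδ
  -- Each of the `a` blocks and the final chain `q` loses at most one Fano term per user, which
  -- gives the factor `H + 1`.
  have h8 : (a : ℝ) ≤ H := by
    have : a ≤ H := ha.trans ((Nat.div_le_self _ _).trans (by simpa using card_le_univ Q))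
    exact_mod_cast this
  have h9 := mul_le_mul_of_nonneg_right h8
    (mul_nonneg (Nat.cast_nonneg (α := ℝ) (Fintype.card (User H r))) hδ)
  rw [condEntropy_eq_residual]
  -- Bits of `S_Q` belong to files demanded outside `𝓚_Q` and are stored only outside `𝓚_Q`, so none
  -- of them is among the bits known to `𝓚_Q`.
  have h10 := S.residual_anti d (A := S.knownBits d (usersWithin r Q))
    (A' := univ.filter fun b => (b.1, S.owners b) ∉ acyclicSet d (univ \ usersWithin r Q)
          (p₀.filter fun k => k ∈ univ \ usersWithin r Q)) (by
      intro b hb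
      rw [mem_filter]
      refine ⟨mem_univ _, fun hb' => ?_⟩
      obtain ⟨k, hk, hk1, hk2⟩ := exists_of_mem_acyclicSet hb'
      have hk3 : k ∉ usersWithin r Q := by simpa using (List.mem_filter.mp hk).2
      rcases (mem_filter.mp hb).2 with h | h
      · obtain ⟨z, hz, hzk⟩ := mem_image.mp h
        exact hk3 (hd (hzk.trans hk1) ▸ hz)
      · exact h (disjoint_of_subset_left hk2 sdiff_disjoint)) Q
  nlinarith

theorem sum_bound (hr : 1 ≤ r) (hB : 1 ≤ B) {ε : ℝ} (h0 : 0 < ε) (h1 : ε < 1)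
    (herr : S.ErrorAtMost ε) {d : Demand H r N} (hd : Function.Injective d) {b : ℕ} (hb : r ≤ b)
    {p : List (User H r)} (hp : IsPermOf univ p) :
    chainSumOf (fun k W => coeffC H r (insert k W) b * S.subfileSize (d k) W) univ p ≤
      (∑ Q ∈ univ.filter (fun Q : Finset (Fin H) => Q.card = b),
        condEntropy (S.relayMessages d Q)
          (S.otherSubfiles (acyclicSet d (univ \ usersWithin r Q)
            (p.filter fun k => k ∈ univ \ usersWithin r Q)))) +
      2 ^ H * Fintype.card (User H r) * fanoBound ε * B := by
  have hδ : 0 ≤ fanoBound ε * B := mul_nonneg (fanoBound_nonneg h0 h1) (Nat.cast_nonneg _)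
  -- The coefficient is expressed through the file index instead of the user, so that the chain sum
  -- becomes a sum over bits.
  let f : Fin N → Finset (User H r) → ℝ := fun i W =>
    coeffC H r ((univ.filter fun k => d k = i) ∪ W) b
  have hf : ∀ k W, f (d k) W = coeffC H r (insert k W) b := by
    intro k W
    have : (univ.filter fun k' => d k' = d k) = {k} := by
      ext z
      simp [hd.eq_iff]
    simp only [f, this]
    rfl
  simp only [← hf]
  rw [S.chainSumOf_mul_subfileSize hd f univ hp.1]
  let D : Finset (Fin H) → Finset (Fin N × Finset (User H r)) := fun Q =>
    acyclicSet d (univ \ usersWithin r Q) (p.filter fun k => k ∈ univ \ usersWithin r Q)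
  -- Bits with coefficient 0 are left out of `T`: for them the count of sets `Q` may exceed `c`, and
  -- this truncation accounts for the `max` with 0 in `coeffC`.
  let T : Finset (Fin N × Fin B) := univ.filter fun b' =>
    (b'.1, S.owners b') ∈ acyclicSet d univ p ∧ 0 < f b'.1 (S.owners b')
  let 𝒬 := univ.filter fun Q : Finset (Fin H) => Q.card = b
  let c : ℝ := (H - 1).choose (b - 1)
  -- conditioning on further bits
  have h2 : ∀ Q, S.residual d Tᶜ Q ≤
      S.residual d (univ.filter fun b' => (b'.1, S.owners b') ∉ D Q) Q +
        (T.filter fun b' => (b'.1, S.owners b') ∉ D Q).card := by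
    intro Q
    have h3 := S.residual_le_add_card d Tᶜ (univ.filter fun b' => (b'.1, S.owners b') ∉ D Q) Q
    have h4 := S.residual_anti d (subset_union_right (s₁ := Tᶜ)
      (s₂ := univ.filter fun b' => (b'.1, S.owners b') ∉ D Q)) Q
    have h5 : (univ.filter fun b' => (b'.1, S.owners b') ∉ D Q) \ Tᶜ =
        T.filter fun b' => (b'.1, S.owners b') ∉ D Q := by
      ext b'
      simp only [mem_sdiff, mem_filter, mem_univ, true_and, mem_compl, not_not]
      tauto
    rw [h5] at h3
    linarith
  have h3 := sum_le_sum fun Q (_ : Q ∈ 𝒬) => h2 Q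
  rw [sum_add_distrib] at h3
  have h4 : c * S.residual d Tᶜ univ ≤ ∑ Q ∈ 𝒬, S.residual d Tᶜ Q :=
    S.choose_mul_residual_le d Tᶜ (hr.trans hb)
  -- all bits in `T` can be decoded
  have h5 : (T.card : ℝ) ≤ S.residual d Tᶜ univ +
      Fintype.card (User H r) * (fanoBound ε * B) := by
    have h6 := S.jointEntropy_univ_le_of_acyclic d hB h0 h1 herr univ p Tᶜ (by
      intro b' hb'
      rw [mem_compl, not_not] at hb'
      exact (mem_filter.mp hb').2.1)
    have h7 := S.card_le_jointEntropy_univ d univ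
    have h8 : (Tᶜ.card : ℝ) = (univ : Finset (Fin N × Fin B)).card - T.card := by
      rw [card_compl, card_univ, Nat.cast_sub (card_le_univ T)]
    have := mul_le_mul_of_nonneg_right (length_le_of_nodup hp.1) hδ
    unfold residual
    linarith
  have hc : c ≤ 2 ^ H := by
    have : (H - 1).choose (b - 1) ≤ 2 ^ H :=
      (Nat.choose_le_two_pow _ _).trans (Nat.pow_le_pow_right (by norm_num) (Nat.sub_le _ _))
    simp only [c]
    exact_mod_cast this
  have hc0 : 0 ≤ c := Nat.cast_nonneg _
  have h6 := mul_le_mul_of_nonneg_left h5 hc0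
  have h7 := mul_le_mul_of_nonneg_right hc
    (mul_nonneg (Nat.cast_nonneg (α := ℝ) (Fintype.card (User H r))) hδ)
  -- counting the conditioned bits
  have h8 : ∑ b' ∈ univ.filter (fun b' : Fin N × Fin B =>
      (b'.1, S.owners b') ∈ acyclicSet d univ p), f b'.1 (S.owners b') ≤
      c * T.card - ∑ Q ∈ 𝒬, ((T.filter fun b' => (b'.1, S.owners b') ∉ D Q).card : ℝ) := by
    have e1 : ∑ Q ∈ 𝒬, ((T.filter fun b' => (b'.1, S.owners b') ∉ D Q).card : ℝ) =
        ∑ b' ∈ T, ((𝒬.filter fun Q => (b'.1, S.owners b') ∉ D Q).card : ℝ) := by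
      simp only [card_filter]
      push_cast
      exact sum_comm
    have e2 : c * T.card = ∑ _b' ∈ T, c := by rw [sum_const, nsmul_eq_mul, mul_comm]
    rw [e1, e2, ← sum_sub_distrib]
    have e3 : T = (univ.filter fun b' : Fin N × Fin B =>
        (b'.1, S.owners b') ∈ acyclicSet d univ p).filter fun b' => 0 < f b'.1 (S.owners b') := by
      rw [filter_filter]
    have e4 : ∑ b' ∈ univ.filter (fun b' : Fin N × Fin B =>
        (b'.1, S.owners b') ∈ acyclicSet d univ p), f b'.1 (S.owners b') ≤
        ∑ b' ∈ T, f b'.1 (S.owners b') := by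
      rw [e3, sum_filter (fun b' : Fin N × Fin B => 0 < f b'.1 (S.owners b'))]
      refine sum_le_sum fun b' _ => ?_
      split_ifs with h
      · exact le_rfl
      · exact not_lt.mp h
    refine e4.trans (sum_le_sum fun b' hb' => ?_)
    obtain ⟨hb1, hb2⟩ := (mem_filter.mp hb').2
    obtain ⟨k, -, hk, -⟩ := exists_of_mem_acyclicSet hb1
    simp only at hk
    rw [hk] at hb1 hb2 ⊢
    rw [hf] at hb2 ⊢
    -- A bit fails to lie in `S_Q` only if `𝓚_Q` meets `{k} ∪ W`; these are exactly the sets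
    -- subtracted in `coeffC`.
    have e5 : ((𝒬.filter fun Q => (d k, S.owners b') ∉ D Q).card : ℝ) ≤
        (univ.filter fun Q : Finset (Fin H) =>
          Q.card = b ∧ ¬ usersWithin r Q ⊆ univ \ insert k (S.owners b')).card := by
      refine Nat.cast_le.mpr (card_le_card fun Q hQ => ?_)
      rw [filter_filter, mem_filter] at hQ
      refine mem_filter.mpr ⟨mem_univ _, hQ.2.1, fun hsub => hQ.2.2 ?_⟩
      have hdis : Disjoint (insert k (S.owners b')) (usersWithin r Q) :=
        (subset_sdiff.mp hsub).2.symm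
      obtain ⟨h9, h10⟩ := disjoint_insert_left.mp hdis
      exact mem_acyclicSet_filter hd _ hb1 h9 h10
    unfold coeffC at hb2 ⊢
    rcases max_cases ((((H - 1).choose (b - 1) : ℕ) : ℝ) - ((univ.filter fun Q : Finset (Fin H) =>
      Q.card = b ∧ ¬ usersWithin r Q ⊆ univ \ insert k (S.owners b')).card : ℝ)) 0 with h | h
    · rw [h.1]
      simp only [c]
      linarith
    · rw [h.1] at hb2
      exact absurd hb2 (lt_irrefl 0)
  simp only [condEntropy_eq_residual]
  change _ ≤ (∑ Q ∈ 𝒬, S.residual d (univ.filter fun b' => (b'.1, S.owners b') ∉ D Q) Q) + _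
  nlinarith

end UncodedScheme

end CombNet

namespace CombNet

variable {H r N B : ℕ}

theorem coeffC_nonneg (W : Finset (User H r)) (l : ℕ) : 0 ≤ coeffC H r W l := le_max_right _ _

theorem chainSumOf_nonneg {g : User H r → Finset (User H r) → ℝ} (hg : ∀ k W, 0 ≤ g k W)
    (A : Finset (User H r)) (v : List (User H r)) : 0 ≤ chainSumOf g A v :=
  sum_nonneg fun _ _ => sum_nonneg fun _ _ => hg _ _

theorem LoadConstraints.mono {R : ℝ} {x : Finset (User H r) → ℝ} {y : Finset (Fin H) → ℝ}
    {η η' : ℝ} (h : LoadConstraints R x y η) (hη : η ≤ η') : LoadConstraints R x y η' :=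
  fun Q hQ a ha ha' P hP hPd hPQ p hp V hV q hq =>
    (h Q hQ a ha ha' P hP hPd hPQ p hp V hV q hq).trans (by linarith)

theorem YConstraints.mono {x : Finset (User H r) → ℝ} {y : Finset (Fin H) → ℝ}
    {η η' : ℝ} (h : YConstraints x y η) (hη : η ≤ η') : YConstraints x y η' :=
  fun b hb hb' p hp => (h b hb hb' p hp).trans (by linarith)

/-! ### Averaging over the distinct demands -/

theorem distinctDemands_card_pos (hN : H.choose r ≤ N) : 0 < (distinctDemands H r N).card := by
  have hK : Fintype.card (User H r) = H.choose r := by simp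
  obtain ⟨e⟩ := Function.Embedding.nonempty_of_card_le (α := User H r) (β := Fin N)
    (by rw [hK, Fintype.card_fin]; exact hN)
  exact card_pos.mpr ⟨e, mem_filter.mpr ⟨mem_univ _, e.injective⟩⟩

/-- Translating all demands by `t` modulo `N` preserves distinctness, so each single demand is
equidistributed over the files. -/
theorem sum_distinctDemands (hN : 0 < N) (k : User H r) (g : Fin N → ℝ) :
    (N : ℝ) * ∑ d ∈ distinctDemands H r N, g (d k) =
      (distinctDemands H r N).card * ∑ i, g i := by
  have : NeZero N := ⟨hN.ne'⟩
  have h1 : ∀ t : Fin N, ∑ d ∈ distinctDemands H r N, g (d k + t) =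
      ∑ d ∈ distinctDemands H r N, g (d k) := by
    intro t
    refine sum_bij' (fun d _ z => d z + t) (fun d _ z => d z - t) ?_ ?_ ?_ ?_ ?_
    · intro d hd
      exact mem_filter.mpr ⟨mem_univ _, (add_left_injective t).comp (mem_filter.mp hd).2⟩
    · intro d hd
      exact mem_filter.mpr ⟨mem_univ _, (sub_left_injective (b := t)).comp (mem_filter.mp hd).2⟩
    · intro d _
      simp
    · intro d _
      simp
    · intro d _
      rfl
  have h2 : ∑ t : Fin N, ∑ d ∈ distinctDemands H r N, g (d k + t) =
      N * ∑ d ∈ distinctDemands H r N, g (d k) := by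
    rw [sum_congr rfl fun t _ => h1 t]
    simp
  rw [← h2, sum_comm, ← nsmul_eq_mul, ← sum_const]
  exact sum_congr rfl fun d _ => Equiv.sum_comp (Equiv.addLeft (d k)) g

namespace UncodedScheme

variable (S : UncodedScheme H r N B)

theorem sum_chainSumOf (hN : 0 < N) (hB : 1 ≤ B) (f : User H r → Finset (User H r) → ℝ)
    (A : Finset (User H r)) (v : List (User H r)) :
    ∑ d ∈ distinctDemands H r N, chainSumOf (fun k W => f k W * S.subfileSize (d k) W) A v =
      (distinctDemands H r N).card * B * chainSumOf (fun k W => f k W * S.x W) A v := by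
  have hN' : (N : ℝ) ≠ 0 := by exact_mod_cast hN.ne'
  have hB' : (B : ℝ) ≠ 0 := by exact_mod_cast (by omega : B ≠ 0)
  unfold chainSumOf
  rw [sum_comm, mul_sum]
  refine sum_congr rfl fun j _ => ?_
  rw [sum_comm, mul_sum]
  refine sum_congr rfl fun W _ => ?_
  have h := sum_distinctDemands hN (v.get j) fun i => (S.subfileSize i W : ℝ)
  rw [← mul_sum]
  unfold x
  field_simp
  linear_combination f (v.get j) W * h

theorem sum_condEntropy (hN : H.choose r ≤ N) (hB : 1 ≤ B) (Q : Finset (Fin H))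
    (p : List (User H r)) :
    ∑ d ∈ distinctDemands H r N, condEntropy (S.relayMessages d Q)
      (S.otherSubfiles (acyclicSet d (univ \ usersWithin r Q)
        (p.filter fun k => k ∈ univ \ usersWithin r Q))) =
      (distinctDemands H r N).card * B * S.yPerm Q p := by
  have hD : ((distinctDemands H r N).card : ℝ) ≠ 0 := by
    exact_mod_cast (distinctDemands_card_pos hN).ne'
  have hB' : (B : ℝ) ≠ 0 := by exact_mod_cast (by omega : B ≠ 0)
  unfold yPerm
  rw [mul_div_cancel₀ _ (mul_ne_zero hD hB')]

theorem placementConstraints (hN : 0 < N) (hB : 1 ≤ B) {M : ℝ} (hM : S.MemoryAtMost M) :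
    PlacementConstraints N M S.x := by
  have hN' : (0 : ℝ) < N := by exact_mod_cast hN
  have hB' : (0 : ℝ) < B := by exact_mod_cast hB
  have hsum : ∀ P : Finset (Finset (User H r)), ∑ W ∈ P, S.x W =
      ((univ.filter fun b : Fin N × Fin B => S.owners b ∈ P).card : ℝ) / (N * B) := by
    intro P
    unfold x
    rw [← sum_div, sum_comm]
    congr 1
    have h1 : ∀ i : Fin N, ∑ W ∈ P, (S.subfileSize i W : ℝ) =
        ((univ.filter fun b : Fin N × Fin B => S.owners b ∈ P).filter fun b => b.1 = i).card := by
      intro i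
      have := S.sum_mul_subfileSize (fun _ => 1) i P
      simp only [one_mul, sum_const, nsmul_eq_mul, mul_one] at this
      rw [this, filter_filter]
      simp only [and_comm]
    rw [sum_congr rfl fun i _ => h1 i, card_eq_sum_card_fiberwise (f := fun b => b.1) (t := univ)
      (fun _ _ => mem_coe.mpr (mem_univ _))]
    push_cast
    rfl
  refine ⟨fun W => ?_, ?_, fun k => ?_⟩
  · unfold x
    positivity
  · rw [hsum]
    simp [hN'.ne', hB'.ne']
  · rw [hsum]
    have : (univ.filter fun b : Fin N × Fin B =>
        S.owners b ∈ univ.filter fun W : Finset (User H r) => k ∈ W) = S.cache k := by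
      ext b
      simp [mem_owners]
    rw [this, div_le_div_iff₀ (by positivity) hN']
    have := mul_le_mul_of_nonneg_right (hM k) hN'.le
    linarith

theorem loadConstraints (hN : H.choose r ≤ N) (hN0 : 0 < N) (hB : 1 ≤ B) {ε : ℝ}
    (h0 : 0 < ε) (h1 : ε < 1) (herr : S.ErrorAtMost ε) {R : ℝ} (hR : S.LoadAtMost R) :
    LoadConstraints R S.x S.y ((H + 1) * Fintype.card (User H r) * fanoBound ε) := by
  intro Q _ a _ ha' P _ hPd hPQ p hp V hV q hq
  -- `load_bound` holds for every permutation in the entropy term, in particular for the one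
  -- attaining the maximum `y_Q`.
  obtain ⟨⟨p₀, -, hy⟩, -⟩ := S.isGreatest_y Q
  have hD : (0 : ℝ) < (distinctDemands H r N).card := by
    exact_mod_cast distinctDemands_card_pos hN
  have hB' : (0 : ℝ) < B := by exact_mod_cast hB
  have h := sum_le_sum fun d (hd : d ∈ distinctDemands H r N) =>
    S.load_bound hB h0 h1 herr hR (mem_filter.mp hd).2 Q a ha' P hPd hPQ p hp V hV q hq p₀
  have h2 := S.sum_chainSumOf hN0 hB fun _ _ => 1
  simp only [one_mul] at h2
  rw [sum_add_distrib, sum_add_distrib, sum_comm, S.sum_condEntropy hN hB, ← hy, h2,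
    sum_congr rfl fun i _ => h2 univ (p i), ← mul_sum, sum_const, nsmul_eq_mul] at h
  refine le_of_mul_le_mul_left ?_ (mul_pos hD hB')
  -- `chainSum` is definitionally `chainSumOf` with a summand that ignores the user.
  change _ * ((∑ i, chainSumOf (fun _ W => S.x W) univ (p i)) +
    chainSumOf (fun _ W => S.x W) (univ \ V) q + S.y Q) ≤ _
  linarith

theorem yConstraints (hr : 1 ≤ r) (hN : H.choose r ≤ N) (hN0 : 0 < N) (hB : 1 ≤ B) {ε : ℝ}
    (h0 : 0 < ε) (h1 : ε < 1) (herr : S.ErrorAtMost ε) :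
    YConstraints S.x S.y (2 ^ H * Fintype.card (User H r) * fanoBound ε) := by
  intro b hb _ p hp
  have hD : (0 : ℝ) < (distinctDemands H r N).card := by
    exact_mod_cast distinctDemands_card_pos hN
  have hB' : (0 : ℝ) < B := by exact_mod_cast hB
  have h := sum_le_sum fun d (hd : d ∈ distinctDemands H r N) =>
    S.sum_bound hr hB h0 h1 herr (mem_filter.mp hd).2 hb hp
  rw [S.sum_chainSumOf hN0 hB, sum_add_distrib, sum_comm,
    sum_congr rfl fun Q _ => S.sum_condEntropy hN hB Q p, ← mul_sum, sum_const, nsmul_eq_mul] at h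
  -- One `p` serves all `Q` here, so it suffices that `y_Q` is an upper bound.
  have hy : ∑ Q ∈ univ.filter (fun Q : Finset (Fin H) => Q.card = b), S.yPerm Q p ≤
      ∑ Q ∈ univ.filter (fun Q : Finset (Fin H) => Q.card = b), S.y Q :=
    sum_le_sum fun Q _ => (S.isGreatest_y Q).2 ⟨p, hp, rfl⟩
  have hy := mul_le_mul_of_nonneg_left hy (mul_pos hD hB').le
  refine le_of_mul_le_mul_left ?_ (mul_pos hD hB')
  change _ * chainSumOf (fun k W => coeffC H r (insert k W) b * S.x W) univ p ≤ _
  linarith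

end UncodedScheme

/-- Schemes with a small error probability satisfy the constraints up to a small slack. -/
theorem exists_error_bound (hr : 1 ≤ r) (hrH : r ≤ H) (hN : H.choose r ≤ N) {M η : ℝ}
    (hη : 0 < η) : ∃ ε : ℝ, 0 < ε ∧ ∀ B : ℕ, 1 ≤ B → ∀ (S : UncodedScheme H r N B) (R : ℝ),
      S.MemoryAtMost M → S.LoadAtMost R → S.ErrorAtMost ε →
        PlacementConstraints N M S.x ∧ LoadConstraints R S.x S.y η ∧ YConstraints S.x S.y η := by
  have hN0 : 0 < N := (Nat.choose_pos hrH).trans_le hN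
  let C : ℝ := (H + 1 + 2 ^ H) * Fintype.card (User H r)
  have hC : 0 ≤ C := by positivity
  obtain ⟨ε, h0, h1, hε⟩ := exists_fanoBound_le (δ := η / (C + 1)) (by positivity)
  have hF := fanoBound_nonneg h0 h1
  have hCF : C * fanoBound ε ≤ η := by
    rw [le_div_iff₀ (by positivity)] at hε
    linarith
  have hC' : C * fanoBound ε = (H + 1) * Fintype.card (User H r) * fanoBound ε +
      2 ^ H * Fintype.card (User H r) * fanoBound ε := by
    simp only [C]
    ring
  have p1 : 0 ≤ (H + 1) * Fintype.card (User H r) * fanoBound ε := by positivity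
  have p2 : 0 ≤ 2 ^ H * Fintype.card (User H r) * fanoBound ε := by positivity
  exact ⟨ε, h0, fun B hB S R hM hR herr => ⟨S.placementConstraints hN0 hB hM,
    (S.loadConstraints hN hN0 hB h0 h1 herr hR).mono (by linarith),
    (S.yConstraints hr hN hN0 hB h0 h1 herr).mono (by linarith)⟩⟩

end CombNet

namespace CombNet

variable {H r N : ℕ}

/-! ### Limits of points that satisfy the constraints up to a slack -/

/-- The instance with the single block `Q` and empty `q`, with the nonnegative chain sums dropped.
-/
theorem LoadConstraints.le (hr : 1 ≤ r) {R η : ℝ} {x : Finset (User H r) → ℝ}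
    {y : Finset (Fin H) → ℝ} (h : LoadConstraints R x y η) (hx : ∀ W, 0 ≤ x W)
    {Q : Finset (Fin H)} (hQ : r ≤ Q.card) : y Q ≤ Q.card * R + η := by
  have h1 := h Q hQ 1 le_rfl ((Nat.one_le_div_iff hr).mpr hQ) (fun _ => Q) (fun _ => hQ)
    (fun i j hij => absurd (Subsingleton.elim i j) hij) (by ext; simp)
    (fun _ => (usersWithin r Q).toList) (fun _ => ⟨nodup_toList _, toList_toFinset _⟩)
    (usersWithin r Q) (by ext; simp) [] ⟨List.nodup_nil, by simp⟩
  have h2 : 0 ≤ ∑ _i : Fin 1, chainSum x univ (usersWithin r Q).toList :=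
    sum_nonneg fun _ _ => chainSumOf_nonneg (g := fun _ => x) (fun _ => hx) _ _
  have h3 : 0 ≤ chainSum x (univ \ usersWithin r Q) [] :=
    chainSumOf_nonneg (g := fun _ => x) (fun _ => hx) _ _
  linarith

theorem YConstraints.neg_le {η : ℝ} {x : Finset (User H r) → ℝ} {y : Finset (Fin H) → ℝ}
    (h : YConstraints x y η) (hx : ∀ W, 0 ≤ x W) {b : ℕ} (hb : r ≤ b) (hbH : b ≤ H) :
    -η ≤ ∑ Q ∈ univ.filter (fun Q : Finset (Fin H) => Q.card = b), y Q := by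
  have h1 := h b hb hbH univ.toList ⟨nodup_toList _, toList_toFinset _⟩
  have h2 : 0 ≤ weightedChainSum x b (univ : Finset (User H r)).toList :=
    chainSumOf_nonneg (g := fun k W => coeffC H r (insert k W) b * x W)
      (fun _ _ => mul_nonneg (coeffC_nonneg _ _) (hx _)) _ _
  linarith

theorem continuous_chainSum (A : Finset (User H r)) (v : List (User H r)) :
    Continuous fun x : Finset (User H r) → ℝ => chainSum x A v := by
  unfold chainSum
  fun_prop

theorem continuous_weightedChainSum (b : ℕ) (v : List (User H r)) :
    Continuous fun x : Finset (User H r) → ℝ => weightedChainSum x b v := by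
  unfold weightedChainSum
  fun_prop

open Filter Topology in
-- Compactness: `x` lies in the unit cube. Each `y_Q` is bounded above by `LoadConstraints.le`,
-- hence below by `YConstraints.neg_le`, since the other terms of the sum are bounded above. All
-- constraints pass to limits.
theorem exists_feasible_of_tendsto (hr : 1 ≤ r) {M R : ℝ} {Rs ηs : ℕ → ℝ}
    {xs : ℕ → Finset (User H r) → ℝ} {ys : ℕ → Finset (Fin H) → ℝ}
    (hR : Tendsto Rs atTop (𝓝 R)) (hη : Tendsto ηs atTop (𝓝 0))
    (hP : ∀ n, PlacementConstraints N M (xs n))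
    (hL : ∀ n, LoadConstraints (Rs n) (xs n) (ys n) (ηs n))
    (hY : ∀ n, YConstraints (xs n) (ys n) (ηs n)) : ∃ x y, (R, x, y) ∈ feasible H r N M := by
  obtain ⟨R₀, hR₀⟩ := hR.bddAbove_range
  obtain ⟨η₀, hη₀⟩ := hη.bddAbove_range
  have hR₀ : ∀ n, Rs n ≤ R₀ := fun n => hR₀ ⟨n, rfl⟩
  have hη₀ : ∀ n, ηs n ≤ η₀ := fun n => hη₀ ⟨n, rfl⟩
  -- The `y_Q` with fewer than `r` relays occur in no constraint and could be unbounded, so they are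
  -- set to 0.
  let ys' : ℕ → Finset (Fin H) → ℝ := fun n Q => if r ≤ Q.card then ys n Q else 0
  have hys' : ∀ n Q, r ≤ Q.card → ys' n Q = ys n Q := fun n Q hQ => if_pos hQ
  have hL' : ∀ n, LoadConstraints (Rs n) (xs n) (ys' n) (ηs n) := by
    intro n Q hQ
    rw [hys' n Q hQ]
    exact hL n Q hQ
  have hY' : ∀ n, YConstraints (xs n) (ys' n) (ηs n) := by
    intro n b hb hbH p hp
    rw [sum_congr rfl fun Q hQ => hys' n Q (by rw [(mem_filter.mp hQ).2]; exact hb)]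
    exact hY n b hb hbH p hp
  let U : ℝ := H * |R₀| + |η₀|
  have hU : 0 ≤ U := by positivity
  have hup : ∀ n Q, ys' n Q ≤ U := by
    intro n Q
    by_cases hQ : r ≤ Q.card
    · have h1 := (hL' n).le hr (hP n).nonneg hQ
      have h2 : (Q.card : ℝ) * Rs n ≤ Q.card * |R₀| :=
        mul_le_mul_of_nonneg_left ((hR₀ n).trans (le_abs_self _)) (Nat.cast_nonneg _)
      have h3 : (Q.card : ℝ) * |R₀| ≤ H * |R₀| :=
        mul_le_mul_of_nonneg_right (by exact_mod_cast by simpa using card_le_univ Q)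
          (abs_nonneg _)
      have h4 := (hη₀ n).trans (le_abs_self _)
      simp only [U]
      linarith
    · simp only [ys', if_neg hQ]
      exact hU
  have hlow : ∀ n Q, -(|η₀| + 2 ^ H * U) ≤ ys' n Q := by
    intro n Q
    by_cases hQ : r ≤ Q.card
    · have h1 := (hY' n).neg_le (hP n).nonneg hQ (by simpa using card_le_univ Q)
      have hmem : Q ∈ univ.filter (fun Q' : Finset (Fin H) => Q'.card = Q.card) := by simp
      rw [← add_sum_erase _ _ hmem] at h1
      have h2 : ∑ Q' ∈ (univ.filter (fun Q' : Finset (Fin H) => Q'.card = Q.card)).erase Q,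
          ys' n Q' ≤ 2 ^ H * U := by
        refine (sum_le_card_nsmul _ _ U fun Q' _ => hup n Q').trans ?_
        rw [nsmul_eq_mul]
        refine mul_le_mul_of_nonneg_right ?_ hU
        have := card_le_univ ((univ.filter fun Q' : Finset (Fin H) => Q'.card = Q.card).erase Q)
        rw [Fintype.card_finset, Fintype.card_fin] at this
        exact_mod_cast this
      have h3 := (hη₀ n).trans (le_abs_self _)
      linarith
    · simp only [ys', if_neg hQ]
      have : 0 ≤ |η₀| + 2 ^ H * U := by positivity
      linarith
  have hx1 : ∀ n W, xs n W ≤ 1 := by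
    intro n W
    rw [← (hP n).sum_eq_one]
    exact single_le_sum (f := xs n) (fun W _ => (hP n).nonneg W) (mem_univ W)
  obtain ⟨⟨x, y⟩, -, φ, hφ, hlim⟩ :=
    ((isCompact_Icc (a := (0 : Finset (User H r) → ℝ)) (b := 1)).prod
      (isCompact_Icc (a := fun _ : Finset (Fin H) => -(|η₀| + 2 ^ H * U)) (b := fun _ => U))
      ).tendsto_subseq (x := fun n => (xs n, ys' n))
      fun n => ⟨⟨fun W => (hP n).nonneg W, hx1 n⟩, ⟨hlow n, hup n⟩⟩
  have hx : Tendsto (fun n => xs (φ n)) atTop (𝓝 x) := (continuous_fst.tendsto _).comp hlim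
  have hy : Tendsto (fun n => ys' (φ n)) atTop (𝓝 y) := (continuous_snd.tendsto _).comp hlim
  have hxW := fun W => tendsto_pi_nhds.mp hx W
  have hyQ := fun Q => tendsto_pi_nhds.mp hy Q
  have hRφ := hR.comp hφ.tendsto_atTop
  have hηφ := hη.comp hφ.tendsto_atTop
  have hc := fun A v => ((continuous_chainSum (H := H) (r := r) A v).tendsto x).comp hx
  refine ⟨x, y, ⟨fun W => ?_, ?_, fun k => ?_⟩, ?_, ?_⟩
  · exact ge_of_tendsto' (hxW W) fun n => (hP _).nonneg W
  · refine tendsto_nhds_unique (tendsto_finsetSum univ fun W _ => hxW W) ?_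
    simp only [(hP _).sum_eq_one]
    exact tendsto_const_nhds
  · exact le_of_tendsto' (tendsto_finsetSum _ fun W _ => hxW W) fun n => (hP _).memory k
  · intro Q hQ a ha ha' P hP' hPd hPQ p hp V hV q hq
    exact le_of_tendsto_of_tendsto'
      (((tendsto_finsetSum univ fun i _ => hc univ (p i)).add (hc (univ \ V) q)).add (hyQ Q))
      ((hRφ.const_mul (Q.card : ℝ)).add hηφ)
      fun n => hL' (φ n) Q hQ a ha ha' P hP' hPd hPQ p hp V hV q hq
  · intro b hb hbH p hp
    exact le_of_tendsto_of_tendsto' (((continuous_weightedChainSum b p).tendsto x).comp hx)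
      ((tendsto_finsetSum _ fun Q _ => hyQ Q).add hηφ) fun n => hY' (φ n) b hb hbH p hp

open Filter Topology in
theorem exists_optimalLoad_mem_feasible (hr : 1 ≤ r) (hrH : r ≤ H) (hN : H.choose r ≤ N) {M : ℝ}
    (hM : 0 ≤ M) : ∃ x y, (optimalLoad H r N M, x, y) ∈ feasible H r N M := by
  have hN0 : 0 < N := (Nat.choose_pos hrH).trans_le hN
  have hglb := isGLB_optimalLoad H r N M hr hrH hN0 hM
  have hne : {R : ℝ | Achievable H r N M R}.Nonempty := hglb.nonempty
  obtain ⟨Rs, -, -, hRs, hach⟩ := hglb.exists_seq_antitone_tendsto hne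
  have h : ∀ n : ℕ, ∃ x y, PlacementConstraints (H := H) (r := r) N M x ∧
      LoadConstraints (Rs n) x y (1 / ((n : ℝ) + 1)) ∧ YConstraints x y (1 / ((n : ℝ) + 1)) := by
    intro n
    obtain ⟨ε, h0, hε⟩ := exists_error_bound (M := M) hr hrH hN
      (η := 1 / ((n : ℝ) + 1)) (by positivity)
    obtain ⟨B, hB, S, h1, h2, h3⟩ := hach n ε h0
    exact ⟨S.x, S.y, hε B hB S (Rs n) h1 h2 h3⟩
  choose xs ys hP hL hY using h
  exact exists_feasible_of_tendsto hr hRs tendsto_one_div_add_atTop_nhds_zero_nat hP hL hY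

open Filter Topology in
theorem exists_isLeast_feasible (hr : 1 ≤ r) (hrH : r ≤ H) {M : ℝ}
    (hne : {R : ℝ | ∃ x y, (R, x, y) ∈ feasible H r N M}.Nonempty) :
    ∃ v, IsLeast {R : ℝ | ∃ x y, (R, x, y) ∈ feasible H r N M} v := by
  have hbdd : BddBelow {R : ℝ | ∃ x y, (R, x, y) ∈ feasible H r N M} := by
    refine ⟨0, ?_⟩
    rintro R ⟨x, y, hP, hL, hY⟩
    -- For `b = H` the sum is the single term `y univ`, so `0 ≤ y univ ≤ H * R` and hence `R` is
    -- nonnegative.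
    have h1 := hL.le hr hP.nonneg (Q := univ) (by simpa using hrH)
    have h2 := hY.neg_le hP.nonneg hrH le_rfl
    have h3 : univ.filter (fun Q : Finset (Fin H) => Q.card = H) = {univ} := by
      ext Q
      have := card_eq_iff_eq_univ Q
      rw [Fintype.card_fin] at this
      simp [this]
    rw [h3, sum_singleton] at h2
    have h4 : (0 : ℝ) < (univ : Finset (Fin H)).card := by
      rw [card_univ, Fintype.card_fin]
      exact_mod_cast hr.trans hrH
    refine nonneg_of_mul_nonneg_right (a := ((univ : Finset (Fin H)).card : ℝ)) ?_ h4
    simp only at h1 h2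
    linarith
  have hglb := Real.isGLB_sInf hne hbdd
  obtain ⟨Rs, -, -, hRs, hmem⟩ := hglb.exists_seq_antitone_tendsto hne
  choose xs ys hf using hmem
  exact ⟨_, exists_feasible_of_tendsto hr hRs tendsto_const_nhds (fun n => (hf n).1)
    (fun n => (hf n).2.1) (fun n => (hf n).2.2), hglb.1⟩

/-! ### Finitely many linear inequalities -/

section Polyhedral

variable {E : Type} [AddCommGroup E] [Module ℝ E]

/-- The set is given by finitely many linear inequalities. -/
def IsPolyhedral (s : Set E) : Prop :=
  ∃ F : Set ((E →ₗ[ℝ] ℝ) × ℝ), F.Finite ∧ s = {v | ∀ f ∈ F, f.2 ≤ f.1 v}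

/-- The function is a linear function plus a constant. -/
def IsAffineFun (f : E → ℝ) : Prop := ∃ (L : E →ₗ[ℝ] ℝ) (c : ℝ), ∀ v, f v = L v + c

theorem IsAffineFun.const (c : ℝ) : IsAffineFun fun _ : E => c := ⟨0, c, by simp⟩

theorem IsAffineFun.add {f g : E → ℝ} (hf : IsAffineFun f) (hg : IsAffineFun g) :
    IsAffineFun fun v => f v + g v := by
  obtain ⟨L, c, h⟩ := hf
  obtain ⟨L', c', h'⟩ := hg
  exact ⟨L + L', c + c', fun v => by simp only [h, h', LinearMap.add_apply]; ring⟩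

theorem IsAffineFun.const_mul {f : E → ℝ} (hf : IsAffineFun f) (a : ℝ) :
    IsAffineFun fun v => a * f v := by
  obtain ⟨L, c, h⟩ := hf
  exact ⟨a • L, a * c, fun v => by simp only [h, LinearMap.smul_apply, smul_eq_mul]; ring⟩

theorem IsAffineFun.sum {ι : Type} {s : Finset ι} {f : ι → E → ℝ} (hf : ∀ i, IsAffineFun (f i)) :
    IsAffineFun fun v => ∑ i ∈ s, f i v := by
  choose L c h using hf
  exact ⟨∑ i ∈ s, L i, ∑ i ∈ s, c i, fun v => by
    rw [LinearMap.sum_apply, ← sum_add_distrib]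
    exact sum_congr rfl fun i _ => h i v⟩

theorem IsPolyhedral.le {f g : E → ℝ} (hf : IsAffineFun f) (hg : IsAffineFun g) :
    IsPolyhedral {v | f v ≤ g v} := by
  obtain ⟨L, c, h⟩ := hf
  obtain ⟨L', c', h'⟩ := hg
  refine ⟨{(L' - L, c - c')}, Set.finite_singleton _, ?_⟩
  ext v
  simp only [Set.mem_ofPred_eq, Set.mem_singleton_iff, forall_eq, LinearMap.sub_apply, h, h']
  constructor <;> intro _ <;> linarith

theorem IsPolyhedral.and {p q : E → Prop} (hp : IsPolyhedral {v | p v})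
    (hq : IsPolyhedral {v | q v}) : IsPolyhedral {v | p v ∧ q v} := by
  obtain ⟨F, hF, h⟩ := hp
  obtain ⟨F', hF', h'⟩ := hq
  refine ⟨F ∪ F', hF.union hF', ?_⟩
  ext v
  have h1 : p v ↔ _ := Set.ext_iff.mp h v
  have h2 : q v ↔ _ := Set.ext_iff.mp h' v
  simp only [Set.mem_ofPred_eq, h1, h2, Set.mem_union]
  exact ⟨fun hv f hf => hf.elim (hv.1 f) (hv.2 f),
    fun hv => ⟨fun f hf => hv f (Or.inl hf), fun f hf => hv f (Or.inr hf)⟩⟩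

theorem IsPolyhedral.imp {c : Prop} {p : E → Prop} (hp : c → IsPolyhedral {v | p v}) :
    IsPolyhedral {v | c → p v} := by
  by_cases hc : c
  · simpa [hc] using hp hc
  · exact ⟨∅, Set.finite_empty, by simp [hc]⟩

/-- A universal statement whose instances outside a finite set are trivial. -/
theorem IsPolyhedral.forall_of_finite {ι : Type} {p : ι → E → Prop} (T : Set ι) (hT : T.Finite)
    (htriv : ∀ i ∉ T, ∀ v, p i v) (hp : ∀ i, IsPolyhedral {v | p i v}) :
    IsPolyhedral {v | ∀ i, p i v} := by
  choose F hF h using hp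
  refine ⟨⋃ i ∈ T, F i, hT.biUnion fun i _ => hF i, ?_⟩
  ext v
  have h1 : ∀ i, p i v ↔ _ := fun i => Set.ext_iff.mp (h i) v
  simp only [Set.mem_ofPred_eq, Set.mem_iUnion, exists_prop]
  constructor
  · rintro hv f ⟨i, -, hf⟩
    exact (h1 i).mp (hv i) f hf
  · intro hv i
    by_cases hi : i ∈ T
    · exact (h1 i).mpr fun f hf => hv f ⟨i, hi, hf⟩
    · exact htriv i hi v

theorem IsPolyhedral.forall {ι : Type} [Finite ι] {p : ι → E → Prop}
    (hp : ∀ i, IsPolyhedral {v | p i v}) : IsPolyhedral {v | ∀ i, p i v} :=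
  IsPolyhedral.forall_of_finite Set.univ Set.finite_univ (fun i hi => absurd (Set.mem_univ i) hi) hp

theorem IsPolyhedral.exists_fin {s : Set E} (hs : IsPolyhedral s) :
    ∃ (n : ℕ) (L : Fin n → (E →ₗ[ℝ] ℝ)) (c : Fin n → ℝ), s = {v | ∀ i, c i ≤ L i v} := by
  obtain ⟨F, hF, rfl⟩ := hs
  have := hF.to_subtype
  obtain ⟨n, ⟨e⟩⟩ := Finite.exists_equiv_fin F
  refine ⟨n, fun i => (e.symm i).1.1, fun i => (e.symm i).1.2, ?_⟩
  ext v
  simp only [Set.mem_ofPred_eq]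
  exact ⟨fun h i => h _ (e.symm i).2, fun h f hf => by simpa using h (e ⟨f, hf⟩)⟩

end Polyhedral

theorem finite_isPermOf (A : Finset (User H r)) : {l | IsPermOf A l}.Finite :=
  (Set.finite_range fun l : {l : List (User H r) // l.Nodup} => l.1).subset
    fun l hl => ⟨⟨l, hl.1⟩, rfl⟩

/-- The natural numbers and lists in the constraints range over infinite types, but their side
conditions hold for finitely many values only; what remains is a finite intersection of half-spaces.
-/
theorem isPolyhedral_feasible (H r N : ℕ) (M : ℝ) : IsPolyhedral (feasible H r N M) := by
  let E := ℝ × (Finset (User H r) → ℝ) × (Finset (Fin H) → ℝ)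
  have hR : IsAffineFun fun v : E => v.1 := ⟨LinearMap.fst ℝ _ _, 0, fun v => (add_zero v.1).symm⟩
  have hx : ∀ W, IsAffineFun fun v : E => v.2.1 W := fun W =>
    ⟨LinearMap.proj W ∘ₗ LinearMap.fst ℝ _ _ ∘ₗ LinearMap.snd ℝ _ _, 0,
      fun v => (add_zero (v.2.1 W)).symm⟩
  have hy : ∀ Q, IsAffineFun fun v : E => v.2.2 Q := fun Q =>
    ⟨LinearMap.proj Q ∘ₗ LinearMap.snd ℝ _ _ ∘ₗ LinearMap.snd ℝ _ _, 0,
      fun v => (add_zero (v.2.2 Q)).symm⟩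
  have hc : ∀ A v, IsAffineFun fun z : E => chainSum z.2.1 A v := fun A v =>
    IsAffineFun.sum fun _ => IsAffineFun.sum fun W => hx W
  refine IsPolyhedral.and ?_ (IsPolyhedral.and ?_ ?_)
  · have h : {v : E | PlacementConstraints N M v.2.1} = {v : E | (∀ W, 0 ≤ v.2.1 W) ∧
        ((∑ W, v.2.1 W ≤ 1) ∧ (1 ≤ ∑ W, v.2.1 W)) ∧ ∀ k : User H r,
        ∑ W ∈ univ.filter (fun W : Finset (User H r) => k ∈ W), v.2.1 W ≤ M / N} := by
      ext v
      exact ⟨fun h => ⟨h.nonneg, ⟨h.sum_eq_one.le, h.sum_eq_one.ge⟩, h.memory⟩,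
        fun h => ⟨h.1, le_antisymm h.2.1.1 h.2.1.2, h.2.2⟩⟩
    rw [h]
    have hs : IsAffineFun fun v : E => ∑ W, v.2.1 W := IsAffineFun.sum hx
    exact (IsPolyhedral.forall fun W => .le (.const 0) (hx W)).and
      (((IsPolyhedral.le hs (.const 1)).and (.le (.const 1) hs)).and
        (.forall fun k => .le (.sum hx) (.const _)))
  · refine .forall fun Q => .imp fun _ => ?_
    refine .forall_of_finite {a | a ≤ Q.card / r} (Set.finite_le_nat _)
      (fun a ha v _ ha' => absurd ha' ha) fun a => .imp fun _ => .imp fun _ => ?_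
    refine .forall fun P => .imp fun _ => .imp fun _ => .imp fun _ => ?_
    refine .forall_of_finite {p | ∀ i, IsPermOf (usersWithin r (P i)) (p i)} ?_
      (fun p hp v hp' => absurd hp' hp) fun p => .imp fun _ => ?_
    · have := Set.Finite.pi' fun i => finite_isPermOf (usersWithin r (P i))
      exact this
    refine .forall fun V => .imp fun _ => ?_
    refine .forall_of_finite _ (finite_isPermOf (usersWithin r Q \ V))
      (fun q hq v hq' => absurd hq' hq) fun q => .imp fun _ => ?_
    exact .le (((IsAffineFun.sum fun i => hc univ (p i)).add (hc _ q)).add (hy Q))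
      ((hR.const_mul _).add (.const 0))
  · refine .forall_of_finite {b | b ≤ H} (Set.finite_le_nat _)
      (fun b hb v _ hb' => absurd hb' hb) fun b => .imp fun _ => .imp fun _ => ?_
    refine .forall_of_finite _ (finite_isPermOf univ)
      (fun p hp v hp' => absurd hp' hp) fun p => .imp fun _ => ?_
    exact .le (.sum fun _ => .sum fun W => (hx W).const_mul _)
      ((IsAffineFun.sum hy).add (.const 0))

end CombNet

theorem mainTheorem3 (H r N : ℕ) (M : ℝ) (hr : 1 ≤ r) (hrH : r ≤ H) (hN : H.choose r ≤ N)
    (hM0 : 0 ≤ M) (hMN : M ≤ N) :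
    -- every scheme with small error probability satisfies the constraints up to a small slack
    (∀ η : ℝ, 0 < η → ∃ ε : ℝ, 0 < ε ∧ ∀ B : ℕ, 1 ≤ B →
      ∀ (S : CombNet.UncodedScheme H r N B) (R : ℝ),
        S.MemoryAtMost M → S.LoadAtMost R → S.ErrorAtMost ε →
          CombNet.PlacementConstraints N M S.x ∧
          CombNet.LoadConstraints R S.x S.y η ∧
          CombNet.YConstraints S.x S.y η) ∧
    -- the optimal load satisfies the constraints exactly, for suitable values of `x` and `y`
    (∃ x y, (CombNet.optimalLoad H r N M, x, y) ∈ CombNet.feasible H r N M) ∧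
    -- the constraints are those of a linear program
    (∃ (n : ℕ)
      (L : Fin n → ((ℝ × (Finset (CombNet.User H r) → ℝ) × (Finset (Fin H) → ℝ)) →ₗ[ℝ] ℝ))
      (c : Fin n → ℝ), CombNet.feasible H r N M = {v | ∀ i, c i ≤ L i v}) ∧
    -- which has an optimal value, and this value is a lower bound for the optimal load
    (∃ v : ℝ, IsLeast {R : ℝ | ∃ x y, (R, x, y) ∈ CombNet.feasible H r N M} v ∧
      v ≤ CombNet.optimalLoad H r N M) := by
  have hopt := CombNet.exists_optimalLoad_mem_feasible (N := N) hr hrH hN hM0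
  obtain ⟨v, hv⟩ := CombNet.exists_isLeast_feasible hr hrH ⟨_, hopt⟩
  exact ⟨fun _ hη => CombNet.exists_error_bound hr hrH hN hη, hopt,
    (CombNet.isPolyhedral_feasible H r N M).exists_fin, v, hv, hv.2 hopt⟩
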